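/- **Setting.** Let $h\in\mathbb N$, let $k_1,\dots,k_h$ be positive integers and $n=\prod_{i} k_i$. Let $\mathcal T$ be the rooted tree with levels $h,h-1,\dots,0$ whose root is on level $h$, in which every node on level $i\ge 1$ has exactly $k_i$ children (on level $i-1$), and whose $n$ leaves (level $0$) are identified with the variables $x_1,\dots,x_n$. Let $\mathbf{Aut}(\mathcal T)$ be the automorphism group of the rooted tree; it acts on the nodes and on the leaves. A *block* is the set of all children of a non-leaf node (that is, a non-root node together with its siblings). A *$\mathrm{MOD}_m$-circuit* $C$ is a finite directed acyclic multigraph with a designated root. The gates without incoming edges are the input gates; each is labelled with a variable, and every variable labels exactly one input gate. Every other gate is labelled with a set $R\subseteq\mathbb Z_m$ and outputs $1$ if the sum modulo $m$ of its inputs (counted with edge multiplicities) is in $R$, and $0$ otherwise. $V(C)$ is the set of gates, and $C$ computes $\mathrm{AND}_n$ if for every Boolean assignment the root has value $1$ exactly when all variables are $1$. A permutation $\sigma$ of $V(C)$ *extends* $\pi\in\mathbf{Aut}(\mathcal T)$ if it preserves the root, the edge multiplicities and the sets $R$, and maps the input gate of each $x$ to the input gate of $\pi(x)$. $C$ is *$\mathbf{Aut}(\mathcal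 T)$-symmetric* if every $\pi\in\mathbf{Aut}(\mathcal T)$ is extended by some $\sigma$. For a gate $g$, let $\mathbf{Stab}(g)$ be the group of all $\pi\in\mathbf{Aut}(\mathcal T)$ that are extended by some $\sigma$ with $\sigma(g)=g$. A set $S\subseteq B$ is a *$B$-support* of $g$ if every permutation of $B$ that fixes $S$ pointwise is the restriction to $B$ of some element of $\mathbf{Stab}(g)$ that maps $B$ to itself. If $g$ has exactly one $B$-support of minimum cardinality, then $\mathrm{supp}_B(g)$ is defined to be this set. If it is defined for all gates, then $\mathrm{maxSup}_B(C)=\max_{g\in V(C)}|\mathrm{supp}_B(g)|$. **Theorem.** Let $m>3$ be an integer with exactly $r$ distinct prime divisors, and let $C$ be an $\mathbf{Aut}(\mathcal T)$-symmetric $\mathrm{MOD}_m$-circuit (for example the $n$-th member of a family $(C_n)_n$ with block sizes $k_i=k_i(n)$). 1. Let $B$ be a block of size $|B|=k_j\ge 2$, for some $j\in\{1,\dots,h\}$, such that $\mathrm{supp}_B(g)$ is defined for every gate $g$. If $\mathrm{maxSup}_B(C)<(k_j/m)^{1/r}$, then $C$ does not compute $\mathrm{AND}_n$. 2. If $k_i>8$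 for all $i$ and $C$ computes $\mathrm{AND}_n$, then, with $k_{\max}=\max_i k_i$, $$|V(C)|\ \ge\ \binom{k_{\max}}{\lceil (k_{\max}/m)^{1/r}\rceil}.$$ -/

import Mathlib

/-! ### Trees with nested blocks

`k : Fin h → ℕ` lists the branching numbers; `k i` (with `i = 0, …, h - 1`) is the number of
children of every node on level `i + 1`.  The root is on level `h`, the leaves on level `0`. -/

/-- A node on level `l` is given by the path that leads to it from the root: for every level
`j + 1 > l` it records which of the `k j` children is chosen. -/
structure TreeNode {h : ℕ} (k : Fin h → ℕ) where
  level : ℕ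
  level_le : level ≤ h
  path : (j : Fin h) → level ≤ (j : ℕ) → Fin (k j)

namespace TreeNode

variable {h : ℕ} {k : Fin h → ℕ}

/-- `u` is the parent of `v`. -/
def IsParent (u v : TreeNode k) : Prop :=
  u.level = v.level + 1 ∧
    ∀ (j : Fin h) (hu : u.level ≤ (j : ℕ)) (hv : v.level ≤ (j : ℕ)), u.path j hu = v.path j hv

/-- The block of `v`: all nodes (including `v`) that have the same parent as `v`. -/
def block (v : TreeNode k) : Set (TreeNode k) :=
  {w | ∃ u, IsParent u v ∧ IsParent u w}

end TreeNode

/-- The set of all blocks of the tree (blocks of the nodes other than the root). -/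
def treeBlocks {h : ℕ} (k : Fin h → ℕ) : Set (Set (TreeNode k)) :=
  {B | ∃ v : TreeNode k, v.level < h ∧ B = v.block}

/-- The leaves of the tree; they serve as (indices of) the input variables. -/
def TreeLeaf {h : ℕ} (k : Fin h → ℕ) : Type := {v : TreeNode k // v.level = 0}

/-- The automorphism group of the rooted tree, as a group of permutations of its nodes. -/
def treeAut {h : ℕ} (k : Fin h → ℕ) : Subgroup (Equiv.Perm (TreeNode k)) where
  carrier := {π | ∀ u v, TreeNode.IsParent (π u) (π v) ↔ TreeNode.IsParent u v}
  mul_mem' := by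
    intro a b ha hb u v
    exact (ha (b u) (b v)).trans (hb u v)
  one_mem' := by
    intro u v
    exact Iff.rfl
  inv_mem' := by
    intro a ha u v
    have := ha (a⁻¹ u) (a⁻¹ v)
    simpa using this.symm

theorem treeAut_level_eq {h : ℕ} {k : Fin h → ℕ} {π : Equiv.Perm (TreeNode k)}
    (hπ : π ∈ treeAut k) (v : TreeNode k) : (π v).level = v.level := by
  have exParent : ∀ w : TreeNode k, w.level < h → ∃ u, TreeNode.IsParent u w := fun w hw =>
    ⟨⟨w.level + 1, hw, fun j hj => w.path j (by omega)⟩, rfl, fun j _ _ => rfl⟩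
  have key : ∀ d : ℕ, ∀ v : TreeNode k, h - v.level = d → (π v).level = v.level := by
    intro d
    induction d with
    | zero =>
      intro v hv
      by_contra hne
      have h1 := v.level_le
      have h2 := (π v).level_le
      obtain ⟨u, hu⟩ := exParent (π v) (by omega)
      have h3 : TreeNode.IsParent (π (π⁻¹ u)) (π v) := by simpa using hu
      have h4 := ((hπ _ _).1 h3).1
      have h5 := (π⁻¹ u).level_le
      omega
    | succ d ih =>
      intro v hv
      obtain ⟨u, hu⟩ := exParent v (by omega)
      have h1 := ih u (by have := hu.1; omega)
      have h2 := ((hπ u v).2 hu).1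
      have h3 := hu.1
      omega
  exact key _ v rfl

/-- The embedding of the automorphism group of the tree into the symmetric group on the leaves. -/
def leafHom {h : ℕ} (k : Fin h → ℕ) : treeAut k →* Equiv.Perm (TreeLeaf k) where
  toFun π := Equiv.Perm.subtypePerm (p := fun v : TreeNode k => v.level = 0) π.1
    (fun v => by rw [treeAut_level_eq π.2 v])
  map_one' := rfl
  map_mul' _ _ := rfl

/-- `Γ|_B`: the group of all permutations of `B` that are induced by some element of `Γ` (such an
element fixes `B` setwise). -/
def restrictToBlock {h : ℕ} {k : Fin h → ℕ} (Γ : Subgroup (treeAut k)) (B : Set (TreeNode k)) :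
    Subgroup (Equiv.Perm B) where
  carrier := {π | ∃ σ ∈ Γ, ∀ v : B, σ.1 v.1 = (π v).1}
  mul_mem' := by
    rintro a b ⟨σ, hσ, ha⟩ ⟨τ, hτ, hb⟩
    refine ⟨σ * τ, Γ.mul_mem hσ hτ, fun v => ?_⟩
    change σ.1 (τ.1 v.1) = (a (b v)).1
    rw [hb, ha]
  one_mem' := ⟨1, Γ.one_mem, fun _ => rfl⟩
  inv_mem' := by
    rintro a ⟨σ, hσ, ha⟩
    refine ⟨σ⁻¹, Γ.inv_mem hσ, fun v => ?_⟩
    change σ.1⁻¹ v.1 = (a⁻¹ v).1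
    rw [Equiv.Perm.inv_eq_iff_eq, ha]
    simp

/-- `S ⊆ B` is a `B`-support of `Γ`: every permutation of `B` that fixes `S` pointwise is induced
by an element of `Γ`. -/
def IsBlockSupport {h : ℕ} {k : Fin h → ℕ} (Γ : Subgroup (treeAut k)) (B : Set (TreeNode k))
    (S : Set B) : Prop :=
  fixingSubgroup (Equiv.Perm B) S ≤ restrictToBlock Γ B

/-! ### Circuits with modular counting gates -/

/-- A `MOD_m`-circuit over the variables `X`: a finite directed acyclic multigraph with a
designated root.  `wires g g'` is the multiplicity of the edge from `g` to `g'`; a gate is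
labelled with a variable or with a set `R ⊆ ℤ/m` (the operation `MOD_m^R`).  The gates labelled
with variables are those without incoming edges, and every variable labels exactly one gate. -/
structure ModCircuit (m : ℕ) (X : Type) where
  Gate : Type
  [fintypeGate : Fintype Gate]
  wires : Gate → Gate → ℕ
  acyclic : WellFounded fun g g' => 0 < wires g g'
  root : Gate
  label : Gate → X ⊕ Set (ZMod m)
  input_iff : ∀ g, (∃ x, label g = Sum.inl x) ↔ ∀ g', wires g' g = 0
  existsUnique_input : ∀ x, ∃! g, label g = Sum.inl x

attribute [instance] ModCircuit.fintypeGate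

namespace ModCircuit

variable {m : ℕ} {X : Type}

open Classical in
/-- The Boolean value of a gate under the assignment `x` of the variables. -/
noncomputable def eval (C : ModCircuit m X) (x : X → Bool) : C.Gate → Bool :=
  C.acyclic.fix fun g val =>
    match C.label g with
    | Sum.inl i => x i
    | Sum.inr R =>
        decide ((∑ g' : C.Gate, if hg : 0 < C.wires g' g then
          (C.wires g' g : ZMod m) * ((val g' hg).toNat : ZMod m) else 0) ∈ R)

open Classical in
theorem eval_eq (C : ModCircuit m X) (x : X → Bool) (g : C.Gate) :
    C.eval x g =
      match C.label g with
      | Sum.inl i => x i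
      | Sum.inr R =>
          decide ((∑ g' : C.Gate, (C.wires g' g : ZMod m) * ((C.eval x g').toNat : ZMod m)) ∈ R) := by
  have key : (∑ g' : C.Gate, if _hg : 0 < C.wires g' g then
      (C.wires g' g : ZMod m) * ((C.eval x g').toNat : ZMod m) else 0) =
      ∑ g' : C.Gate, (C.wires g' g : ZMod m) * ((C.eval x g').toNat : ZMod m) := by
    refine Finset.sum_congr rfl fun g' _ => ?_
    by_cases hg : 0 < C.wires g' g
    · simp [hg]
    · have h0 : C.wires g' g = 0 := by omega
      simp [h0]
  rw [← key]
  unfold eval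
  rw [WellFounded.fix_eq]

/-- The circuit computes the conjunction of all its variables. -/
def ComputesAnd (C : ModCircuit m X) : Prop :=
  ∀ x : X → Bool, C.eval x C.root = true ↔ ∀ i, x i = true

/-- `σ` is an automorphism of the circuit (it preserves the root, the edge multiplicities and the
operations of the internal gates) that acts on the input gates like `ρ` acts on the variables. -/
def Extends (C : ModCircuit m X) (ρ : Equiv.Perm X) (σ : Equiv.Perm C.Gate) : Prop :=
  σ C.root = C.root ∧
  (∀ g g', C.wires (σ g) (σ g') = C.wires g g') ∧
  ∀ g, C.label (σ g) = Sum.map ρ id (C.label g)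

/-- The circuit is `Γ`-symmetric: every element of `Γ` extends to an automorphism. -/
def IsSymmetric (C : ModCircuit m X) (Γ : Subgroup (Equiv.Perm X)) : Prop :=
  ∀ ρ ∈ Γ, ∃ σ, C.Extends ρ σ

variable {h : ℕ} {k : Fin h → ℕ}

/-- The stabiliser of a gate in the automorphism group of the tree.  If the circuit is rigid, the
automorphism `σ` that extends `π` is unique, and the condition reads `π(g) = g`. -/
def gateStab (C : ModCircuit m (TreeLeaf k)) (g : C.Gate) : Subgroup (treeAut k) where
  carrier := {π | ∃ σ, C.Extends (leafHom k π) σ ∧ σ g = g}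
  mul_mem' := by
    rintro a b ⟨σ, ⟨h1, h2, h3⟩, h4⟩ ⟨τ, ⟨h1', h2', h3'⟩, h4'⟩
    refine ⟨σ * τ, ⟨?_, ?_, ?_⟩, ?_⟩
    · simp [h1, h1']
    · intro u v
      simp [h2, h2']
    · intro u
      simp [h3, h3', Function.comp_def]
    · simp [h4, h4']
  one_mem' := ⟨1, ⟨rfl, fun _ _ => rfl, fun g => by simp⟩, rfl⟩
  inv_mem' := by
    rintro a ⟨σ, ⟨h1, h2, h3⟩, h4⟩
    refine ⟨σ⁻¹, ⟨?_, ?_, ?_⟩, ?_⟩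
    · rw [Equiv.Perm.inv_eq_iff_eq, h1]
    · intro u v
      have := h2 (σ⁻¹ u) (σ⁻¹ v)
      simpa using this.symm
    · intro u
      have h5 : C.label u = Sum.map (leafHom k a) id (C.label (σ⁻¹ u)) := by
        simpa using h3 (σ⁻¹ u)
      rw [h5, map_inv, Sum.map_map]
      simp
    · rw [Equiv.Perm.inv_eq_iff_eq, h4]

/-- `S` is a minimal `B`-support of the stabiliser of `g`, that is, one of least cardinality. -/
def IsMinSupport (C : ModCircuit m (TreeLeaf k)) (B : Set (TreeNode k)) (g : C.Gate)
    (S : Set B) : Prop :=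
  IsBlockSupport (C.gateStab g) B S ∧
    ∀ S' : Set B, IsBlockSupport (C.gateStab g) B S' → S.ncard ≤ S'.ncard

/-- The support `supp_B(g)` is defined: the stabiliser of `g` has a unique minimal `B`-support. -/
def SupportDefined (C : ModCircuit m (TreeLeaf k)) (B : Set (TreeNode k)) (g : C.Gate) : Prop :=
  ∃! S : Set B, C.IsMinSupport B g S

open Classical in
/-- The unique minimal `B`-support of the stabiliser of `g` (with value `∅` if it is not
defined). -/
noncomputable def supp (C : ModCircuit m (TreeLeaf k)) (B : Set (TreeNode k)) (g : C.Gate) :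
    Set B :=
  if hg : C.SupportDefined B g then hg.choose else ∅

/-- The maximum of `|supp_B(g)|` over all gates `g`. -/
noncomputable def maxSup (C : ModCircuit m (TreeLeaf k)) (B : Set (TreeNode k)) : ℕ :=
  Finset.univ.sup fun g : C.Gate => (C.supp B g).ncard

end ModCircuit

/-! Fix a block $B$ with $N$ elements and feed the circuit only the assignments given by subsets
$S\subseteq B$ (`blockAssignment`). Suppose every gate $g$ carries a set $T(g)\subseteq B$ of at
most $s$ elements, transported equivariantly by the symmetries, such that each even permutation of
$B$ fixing $T(g)$ pointwise is induced by a symmetry fixing $g$. Then the value of $g$ at $S$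
depends only on $S\cap T(g)$ and on $|S|$ modulo $P$ = `choosePeriod m s`
(`eq_of_inter_eq_of_card_modEq`). Indeed, by induction the sum at $g$ is a sum over sets $A=T(g')$
of terms invariant under the even permutations fixing $T(g)$. Sorting the $A$ by their trace on
$T(g)$ and by the number of further points inside and outside $S$ turns it into a combination of
products $\binom{x}{i}\binom{y}{j}$ with $i,j\le s$, which are $P$-periodic modulo $m$
(`sum_inter_eq_of_even_invariant`). The root has $T=\emptyset$, and $P\le m s^r$. So if $m s^r<N$,
the root cannot tell $B$ from a subset with $N-P$ elements, and the circuit does not compute AND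
(`not_computesAnd_of_even_supports`).

For the first statement, $T$ is the minimal support. For the second, orbit counting bounds the index
of each restricted stabiliser by $|V(C)|$. A subgroup of $\mathrm{Sym}(B)$ of index below
$\binom{N}{t}$, with $4t\le N+3$ and $N\ge 9$, contains all even permutations fixing a canonical set
of fewer than $t$ points (`smallClasses_spec`). To see this, call two points related if they lie on
a common three-cycle of the group. This is an equivalence relation, the group contains the
alternating group of every class, and some class has more than $N-t$ points
(`exists_large_threeCycleClass`): otherwise more than $N-t$ points lie in several classes of one
size $a$, and the index is too large, by the order of a wreath product if $a\ge2$ and by Bochert's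
argument if $a=1$. Only even permutations can be hoped for, since the subgroup may be alternating.
-/

/-! ### Periodicity of binomial coefficients modulo `m` -/

/-- A common period modulo `m` of the binomial coefficients `x.choose j` with `j ≤ s`. -/
def choosePeriod (m s : ℕ) : ℕ := m * ∏ p ∈ m.primeFactors, p ^ Nat.log p s

theorem choosePeriod_pos {m : ℕ} (hm : 0 < m) (s : ℕ) : 0 < choosePeriod m s :=
  Nat.mul_pos hm (Finset.prod_pos fun _ hp => pow_pos (Nat.prime_of_mem_primeFactors hp).pos _)

theorem choosePeriod_le (m : ℕ) {s : ℕ} (hs : 0 < s) :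
    choosePeriod m s ≤ m * s ^ m.primeFactors.card :=
  Nat.mul_le_mul_left _ (Finset.prod_le_pow_card _ _ _ fun _ _ => Nat.pow_log_le_self _ hs.ne')

/-- With $P$ the period, $i\binom{P}{i}=P\binom{P-1}{i-1}$, and $i\le s$ cancels at most
$p^{\lfloor\log_p s\rfloor}$. This is exactly the surplus put into the period for each prime $p\mid
m$. -/
theorem dvd_choose_choosePeriod {m s i : ℕ} (hm : 0 < m) (hi : 0 < i) (his : i ≤ s) :
    m ∣ (choosePeriod m s).choose i := by
  rw [Nat.dvd_iff_prime_pow_dvd_dvd]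
  intro p e hp hpe
  rcases Nat.eq_zero_or_pos e with rfl | he
  · simp
  have hpm : p ∈ m.primeFactors :=
    Nat.mem_primeFactors.2 ⟨hp, (dvd_pow_self p he.ne').trans hpe, hm.ne'⟩
  have h1 : p ^ (e + Nat.log p s) ∣ choosePeriod m s := by
    rw [pow_add]
    exact Nat.mul_dvd_mul hpe (Finset.dvd_prod_of_mem _ hpm)
  have h2 : p ^ (e + Nat.log p s) ∣ (choosePeriod m s).choose i * i := by
    have h3 := Nat.add_one_mul_choose_eq (choosePeriod m s - 1) (i - 1)
    rw [Nat.sub_add_cancel (choosePeriod_pos hm s), Nat.sub_add_cancel hi] at h3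
    rw [← h3]
    exact h1.mul_right _
  obtain ⟨v, i', hi', rfl⟩ := Nat.exists_eq_pow_mul_and_not_dvd hi.ne' p hp.ne_one
  have hv : v ≤ Nat.log p s := by
    refine Nat.le_log_of_pow_le hp.one_lt (le_trans (Nat.le_of_dvd hi (Dvd.intro _ rfl)) his)
  have h4 : p ^ (e + Nat.log p s) = p ^ v * p ^ (e + Nat.log p s - v) := by
    rw [← pow_add]; congr 1; omega
  rw [h4, show (choosePeriod m s).choose (p ^ v * i') * (p ^ v * i') =
    p ^ v * ((choosePeriod m s).choose (p ^ v * i') * i') by ring] at h2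
  have h5 := Nat.dvd_of_mul_dvd_mul_left (pow_pos hp.pos v) h2
  have h6 : Nat.Coprime (p ^ (e + Nat.log p s - v)) i' :=
    Nat.Coprime.pow_left _ ((Nat.Prime.coprime_iff_not_dvd hp).2 hi')
  exact (pow_dvd_pow p (by omega)).trans (h6.dvd_of_dvd_mul_right h5)

/-- In Vandermonde's expansion of $\binom{P+a}{j}$ every term that takes a positive number of
elements from the $P$ new ones vanishes modulo $m$. -/
theorem choose_cast_eq_of_modEq {m s a b j : ℕ} (hm : 0 < m) (hj : j ≤ s)
    (hab : a ≡ b [MOD choosePeriod m s]) : (a.choose j : ZMod m) = (b.choose j : ZMod m) := by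
  have step : ∀ a : ℕ, ((choosePeriod m s + a).choose j : ZMod m) = (a.choose j : ZMod m) := by
    intro a
    rw [Nat.add_choose_eq, Nat.cast_sum, Finset.sum_eq_single (0, j)]
    · simp
    · rintro ⟨u, v⟩ huv hne
      have huv : u + v = j := Finset.HasAntidiagonal.mem_antidiagonal.1 huv
      have hu : 0 < u := by
        rcases Nat.eq_zero_or_pos u with rfl | hu
        · simp_all
        · exact hu
      have h1 : ((choosePeriod m s).choose u : ZMod m) = 0 :=
        (ZMod.natCast_eq_zero_iff _ _).2 (dvd_choose_choosePeriod hm hu (by omega))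
      simp [h1]
    · simp
  have steps : ∀ q a : ℕ,
      ((choosePeriod m s * q + a).choose j : ZMod m) = (a.choose j : ZMod m) := by
    intro q
    induction q with
    | zero => simp
    | succ q ih =>
      intro a
      rw [Nat.mul_succ, Nat.add_right_comm, Nat.add_comm, step, ih]
  wlog hle : a ≤ b generalizing a b
  · exact (this hab.symm (by omega)).symm
  obtain ⟨q, hq⟩ := (Nat.modEq_iff_dvd' hle).1 hab
  rw [show b = choosePeriod m s * q + a by omega, steps]

/-! ### Sums over subsets that are invariant under even permutations -/

theorem Finset.sum_powerset_union_of_disjoint {α M : Type*} [DecidableEq α] [AddCommMonoid M]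
    {A B : Finset α} (hAB : Disjoint A B) (f : Finset α → M) :
    ∑ T ∈ (A ∪ B).powerset, f T = ∑ Y ∈ A.powerset, ∑ Z ∈ B.powerset, f (Y ∪ Z) := by
  rw [← Finset.sum_product']
  refine Finset.sum_nbij' (fun T => (T ∩ A, T ∩ B)) (fun p => p.1 ∪ p.2) ?_ ?_ ?_ ?_ ?_
  · intro T _
    simp
  · rintro ⟨Y, Z⟩ h
    simp only [Finset.mem_product, Finset.mem_powerset] at h ⊢
    exact Finset.union_subset_union h.1 h.2
  · intro T hT
    rw [Finset.mem_powerset] at hT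
    simp [← Finset.inter_union_distrib_left, Finset.inter_eq_left.2 hT]
  · rintro ⟨Y, Z⟩ h
    simp only [Finset.mem_product, Finset.mem_powerset] at h
    have h1 : Z ∩ A = ∅ := Finset.disjoint_iff_inter_eq_empty.1 (hAB.symm.mono_left h.2)
    have h2 : Y ∩ B = ∅ := Finset.disjoint_iff_inter_eq_empty.1 (hAB.mono_left h.1)
    simp [Finset.union_inter_distrib_right, h1, h2, Finset.inter_eq_left.2 h.1,
      Finset.inter_eq_left.2 h.2]
  · intro T hT
    rw [Finset.mem_powerset] at hT
    simp [← Finset.inter_union_distrib_left, Finset.inter_eq_left.2 hT]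

/-- Even permutations act transitively on pairs of disjoint sets of given sizes outside `Q`. -/
theorem exists_even_perm_map {β : Type*} [Fintype β] [DecidableEq β] {Q Y Z Y' Z' : Finset β}
    (hQY : Disjoint Q Y) (hQZ : Disjoint Q Z) (hYZ : Disjoint Y Z)
    (hQY' : Disjoint Q Y') (hQZ' : Disjoint Q Z') (hYZ' : Disjoint Y' Z')
    (hY : Y.card = Y'.card) (hZ : Z.card = Z'.card)
    (hn : Q.card + Y.card + Z.card + 2 ≤ Fintype.card β) :
    ∃ π : Equiv.Perm β, Equiv.Perm.sign π = 1 ∧ (∀ b ∈ Q, π b = b) ∧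
      Y.map π.toEmbedding = Y' ∧ Z.map π.toEmbedding = Z' := by
  -- Each point of $Q$ gets its own colour, and $Y$, $Z$ and the rest one colour each. A bijection
  -- matching the colourings is what is needed, and it exists because the colour classes have equal
  -- sizes.
  let col : Finset β → Finset β → β → β ⊕ Fin 3 := fun Y Z b =>
    if b ∈ Q then Sum.inl b else if b ∈ Y then Sum.inr 0 else if b ∈ Z then Sum.inr 1
      else Sum.inr 2
  have cQ : ∀ {Y Z : Finset β} {b c : β}, col Y Z b = Sum.inl c ↔ b ∈ Q ∧ b = c := by
    intro Y Z b c
    simp only [col]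
    split_ifs with h1 <;> simp [h1]
  have cY : ∀ {Y Z : Finset β} {b : β}, Disjoint Q Y → (col Y Z b = Sum.inr 0 ↔ b ∈ Y) := by
    intro Y Z b h
    have h0 := Finset.disjoint_left.1 h
    have := @h0 b
    simp only [col]
    split_ifs with h1 h2 <;> simp_all
  have cZ : ∀ {Y Z : Finset β} {b : β}, Disjoint Q Z → Disjoint Y Z →
      (col Y Z b = Sum.inr 1 ↔ b ∈ Z) := by
    intro Y Z b h h'
    have h0 := Finset.disjoint_left.1 h
    have := @h0 b
    have h0' := Finset.disjoint_left.1 h'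
    have := @h0' b
    simp only [col]
    split_ifs with h1 h2 <;> simp_all
  have c2 : ∀ {Y Z : Finset β} {b : β}, col Y Z b = Sum.inr 2 ↔ b ∈ (Q ∪ Y ∪ Z)ᶜ := by
    intro Y Z b
    simp only [col]
    split_ifs with h1 h2 <;> simp_all
  have cU : ∀ {Y Z : Finset β}, Disjoint Q Y → Disjoint Q Z → Disjoint Y Z →
      (Q ∪ Y ∪ Z).card = Q.card + Y.card + Z.card := by
    intro Y Z h1 h2 h3
    rw [Finset.card_union_of_disjoint (Finset.disjoint_union_left.2 ⟨h2, h3⟩),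
      Finset.card_union_of_disjoint h1]
  have hfib : ∀ c, Nonempty ({b // col Y Z b = c} ≃ {b // col Y' Z' b = c}) := by
    intro c
    have key : ∀ A A' : Finset β, (∀ b, col Y Z b = c ↔ b ∈ A) → (∀ b, col Y' Z' b = c ↔ b ∈ A') →
        A.card = A'.card → Nonempty ({b // col Y Z b = c} ≃ {b // col Y' Z' b = c}) := by
      intro A A' h1 h2 h3
      exact ⟨(Equiv.subtypeEquivRight h1).trans ((Finset.equivOfCardEq h3).trans
        (Equiv.subtypeEquivRight h2).symm)⟩
    match c with
    | Sum.inl c =>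
      exact ⟨Equiv.subtypeEquivRight fun b => by rw [cQ, cQ]⟩
    | Sum.inr 0 => exact key Y Y' (fun b => cY hQY) (fun b => cY hQY') hY
    | Sum.inr 1 => exact key Z Z' (fun b => cZ hQZ hYZ) (fun b => cZ hQZ' hYZ') hZ
    | Sum.inr 2 =>
      refine key _ _ (fun b => c2) (fun b => c2) ?_
      rw [Finset.card_compl, Finset.card_compl, cU hQY hQZ hYZ, cU hQY' hQZ' hYZ', hY, hZ]
  have main : ∃ π : Equiv.Perm β, ∀ b, col Y' Z' (π b) = col Y Z b :=
    ⟨Equiv.ofFiberEquiv fun c => (hfib c).some, Equiv.ofFiberEquiv_map _⟩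
  have finish : ∀ π : Equiv.Perm β, (∀ b, col Y' Z' (π b) = col Y Z b) →
      (∀ b ∈ Q, π b = b) ∧ Y.map π.toEmbedding = Y' ∧ Z.map π.toEmbedding = Z' := by
    intro π hπ
    refine ⟨fun b hb => ?_, ?_, ?_⟩
    · have h1 := hπ b
      rw [cQ.2 ⟨hb, rfl⟩] at h1
      exact (cQ.1 h1).2
    · refine Finset.eq_of_subset_of_card_le (fun b hb => ?_) (by rw [Finset.card_map, hY])
      obtain ⟨c, hc, rfl⟩ := Finset.mem_map.1 hb
      exact (cY hQY').1 ((hπ c).trans ((cY hQY).2 hc))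
    · refine Finset.eq_of_subset_of_card_le (fun b hb => ?_) (by rw [Finset.card_map, hZ])
      obtain ⟨c, hc, rfl⟩ := Finset.mem_map.1 hb
      exact (cZ hQZ' hYZ').1 ((hπ c).trans ((cZ hQZ hYZ).2 hc))
  obtain ⟨π, hπ⟩ := main
  rcases Int.units_eq_one_or (Equiv.Perm.sign π) with hs | hs
  · exact ⟨π, hs, finish π hπ⟩
  -- The parity is corrected by a transposition of two points of the last colour; the `+ 2` in the
  -- hypothesis provides them.
  · have h2 : 1 < ((Q ∪ Y ∪ Z)ᶜ).card := by
      rw [Finset.card_compl, cU hQY hQZ hYZ]; omega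
    obtain ⟨u, hu, v, hv, huv⟩ := Finset.one_lt_card.1 h2
    refine ⟨π * Equiv.swap u v, by simp [hs, Equiv.Perm.sign_swap huv], finish _ fun b => ?_⟩
    rw [Equiv.Perm.mul_apply, hπ]
    by_cases hbu : b = u
    · rw [hbu, Equiv.swap_apply_left, c2.2 hu, c2.2 hv]
    · by_cases hbv : b = v
      · rw [hbv, Equiv.swap_apply_right, c2.2 hu, c2.2 hv]
      · rw [Equiv.swap_apply_of_ne_of_ne hbu hbv]

theorem sum_powerset_card_eq_range {β R : Type*} [Semiring R] (A : Finset β) (s : ℕ)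
    (f : ℕ → R) (hf : ∀ i, s < i → f i = 0) :
    ∑ Y ∈ A.powerset, f Y.card = ∑ i ∈ Finset.range (s + 1), (A.card.choose i : R) * f i := by
  rw [Finset.sum_powerset_apply_card]
  simp only [nsmul_eq_mul]
  rcases le_total A.card s with h | h
  · refine Finset.sum_subset (by simpa using h) fun i _ hi => ?_
    rw [Nat.choose_eq_zero_of_lt (by simpa using hi)]
    simp
  · refine (Finset.sum_subset (by simpa using h) fun i _ hi => ?_).symm
    rw [hf i (by simpa using hi), mul_zero]

/-- Write $T=X\cup Y\cup Z$ with $X\subseteq Q$, $Y\subseteq S\setminus Q$ and $Z$ outside $S\cup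
Q$. By invariance the summand depends only on $X,|Y|,|Z|$, so $S$ enters only through $S\cap Q$ and
through binomial coefficients of $|S\setminus Q|$ and $|(S\cup Q)^c|$. -/
theorem sum_inter_eq_of_even_invariant {β : Type*} [Fintype β] [DecidableEq β] {m s : ℕ}
    (hm : 0 < m) (Q : Finset β) (hQ : Q.card ≤ s) (hn : 2 * s + 2 ≤ Fintype.card β)
    (G : Finset β → Finset β → ZMod m) (hG0 : ∀ U T, s < T.card → G U T = 0)
    (hG : ∀ π : Equiv.Perm β, Equiv.Perm.sign π = 1 → (∀ b ∈ Q, π b = b) → ∀ U T,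
      G (U.map π.toEmbedding) (T.map π.toEmbedding) = G U T)
    {S S' : Finset β} (hSQ : S ∩ Q = S' ∩ Q) (hS : S.card ≡ S'.card [MOD choosePeriod m s]) :
    ∑ T, G (S ∩ T) T = ∑ T, G (S' ∩ T) T := by
  obtain ⟨γ, hγ⟩ : ∃ γ : Finset β → ℕ → ℕ → ZMod m, ∀ X Y Z : Finset β, X ⊆ Q →
      Disjoint Q Y → Disjoint Q Z → Disjoint Y Z →
      G (S ∩ X ∪ Y) (X ∪ (Y ∪ Z)) = γ X Y.card Z.card := by
    classical
    refine ⟨fun X i j => if hij : ∃ p : Finset β × Finset β, Disjoint Q p.1 ∧ Disjoint Q p.2 ∧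
      Disjoint p.1 p.2 ∧ p.1.card = i ∧ p.2.card = j then
        G (S ∩ X ∪ hij.choose.1) (X ∪ (hij.choose.1 ∪ hij.choose.2)) else 0, ?_⟩
    intro X Y Z hX h1 h2 h3
    have hij : ∃ p : Finset β × Finset β, Disjoint Q p.1 ∧ Disjoint Q p.2 ∧
      Disjoint p.1 p.2 ∧ p.1.card = Y.card ∧ p.2.card = Z.card := ⟨(Y, Z), h1, h2, h3, rfl, rfl⟩
    simp only [dif_pos hij]
    obtain ⟨h1', h2', h3', hY, hZ⟩ := hij.choose_spec
    set Y' := hij.choose.1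
    set Z' := hij.choose.2
    have cU : ∀ {Y Z : Finset β}, Disjoint Q Y → Disjoint Q Z → Disjoint Y Z →
        Y.card + Z.card ≤ (X ∪ (Y ∪ Z)).card := by
      intro Y Z h1 h2 h3
      rw [← Finset.card_union_of_disjoint h3]
      exact Finset.card_le_card Finset.subset_union_right
    -- For large $Y\cup Z$ both values are zero; otherwise $|Q|+|Y|+|Z|\le 2s$ leaves two free
    -- points for the even permutation.
    by_cases hc : s < Y.card + Z.card
    · rw [hG0 _ _ (hc.trans_le (cU h1 h2 h3)), hG0 _ _ (lt_of_lt_of_le _ (cU h1' h2' h3'))]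
      omega
    · obtain ⟨π, hπ, hπQ, hπY, hπZ⟩ := exists_even_perm_map h1 h2 h3 h1' h2' h3' hY.symm hZ.symm
        (by omega)
      have hfix : ∀ A : Finset β, A ⊆ Q → A.map π.toEmbedding = A := by
        intro A hA
        refine Finset.eq_of_subset_of_card_le (fun b hb => ?_) (by rw [Finset.card_map])
        obtain ⟨c, hc, rfl⟩ := Finset.mem_map.1 hb
        simpa [hπQ c (hA hc)] using hc
      rw [← hG π hπ hπQ, Finset.map_union, Finset.map_union, Finset.map_union, hπY, hπZ, hfix X hX,
        hfix _ (Finset.inter_subset_right.trans hX)]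
  -- The guard `i ≤ s ∧ j ≤ s` makes both sums finite at $s$. It loses nothing because $G$ vanishes
  -- on larger sets.
  have expand : ∀ S' : Finset β, S' ∩ Q = S ∩ Q → ∑ T, G (S' ∩ T) T =
      ∑ X ∈ Q.powerset, ∑ i ∈ Finset.range (s + 1), ((S' \ Q).card.choose i : ZMod m) *
        ∑ j ∈ Finset.range (s + 1), ((S' ∪ Q)ᶜ.card.choose j : ZMod m) *
          if i ≤ s ∧ j ≤ s then γ X i j else 0 := by
    intro S' hS'
    have hd1 : Disjoint (S' \ Q) (S' ∪ Q)ᶜ := by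
      rw [Finset.disjoint_left]; intro b; simp; tauto
    have hd2 : Disjoint Q (S' \ Q ∪ (S' ∪ Q)ᶜ) := by
      rw [Finset.disjoint_left]; intro b; simp +contextual
    have hu : (Finset.univ : Finset (Finset β)) = (Q ∪ (S' \ Q ∪ (S' ∪ Q)ᶜ)).powerset := by
      ext T; simp only [Finset.mem_univ, Finset.mem_powerset, true_iff]
      intro b _; simp; tauto
    rw [hu, Finset.sum_powerset_union_of_disjoint hd2]
    refine Finset.sum_congr rfl fun X hX => ?_
    rw [Finset.mem_powerset] at hX
    rw [Finset.sum_powerset_union_of_disjoint hd1, ← sum_powerset_card_eq_range _ s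
      (fun i => ∑ j ∈ Finset.range (s + 1), ((S' ∪ Q)ᶜ.card.choose j : ZMod m) *
          if i ≤ s ∧ j ≤ s then γ X i j else 0)
      (fun i hi => Finset.sum_eq_zero fun j _ => by rw [if_neg (by omega), mul_zero])]
    refine Finset.sum_congr rfl fun Y hY => ?_
    rw [Finset.mem_powerset] at hY
    rw [← sum_powerset_card_eq_range _ s
      (fun j => if Y.card ≤ s ∧ j ≤ s then γ X Y.card j else 0) (fun j hj => if_neg (by omega))]
    refine Finset.sum_congr rfl fun Z hZ => ?_
    rw [Finset.mem_powerset] at hZ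
    have h1 : Disjoint Q Y := (Finset.disjoint_union_right.1 hd2).1.mono_right hY
    have h2 : Disjoint Q Z := (Finset.disjoint_union_right.1 hd2).2.mono_right hZ
    have h3 : Disjoint Y Z := hd1.mono hY hZ
    have h4 : S' ∩ (X ∪ (Y ∪ Z)) = S ∩ X ∪ Y := by
      have h5 : S' ∩ X = S ∩ X := by
        rw [← Finset.inter_eq_right.2 hX, ← Finset.inter_assoc, hS', Finset.inter_assoc]
      have h6 : S' ∩ Y = Y := Finset.inter_eq_right.2 (hY.trans Finset.sdiff_subset)
      have h7 : S' ∩ Z = ∅ := by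
        rw [← Finset.disjoint_iff_inter_eq_empty, Finset.disjoint_left]
        intro b hb hbZ
        have := hZ hbZ
        simp [hb] at this
      rw [Finset.inter_union_distrib_left, Finset.inter_union_distrib_left, h5, h6, h7,
        Finset.union_empty]
    rw [h4, hγ X Y Z hX h1 h2 h3]
    split_ifs with hc
    · rfl
    · rw [← hγ X Y Z hX h1 h2 h3]
      refine hG0 _ _ (lt_of_lt_of_le (b := Y.card + Z.card) (by omega) ?_)
      rw [← Finset.card_union_of_disjoint h3]
      exact Finset.card_le_card Finset.subset_union_right
  have hc : ∀ A : Finset β, (A \ Q).card + (A ∩ Q).card = A.card := fun A =>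
    Finset.card_sdiff_add_card_inter A Q
  have hc' : ∀ A : Finset β, (A ∪ Q)ᶜ.card + ((A \ Q).card + Q.card) = Fintype.card β := by
    intro A
    rw [← Finset.card_union_of_disjoint Finset.sdiff_disjoint, Finset.sdiff_union_self_eq_union,
      Finset.card_compl_add_card]
  have ha : (S \ Q).card ≡ (S' \ Q).card [MOD choosePeriod m s] := by
    have h1 := hc S
    have h2 := hc S'
    rw [← hSQ] at h2
    rw [← h1, ← h2] at hS
    exact Nat.ModEq.add_right_cancel' _ hS
  have hb : (S ∪ Q)ᶜ.card ≡ (S' ∪ Q)ᶜ.card [MOD choosePeriod m s] := by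
    have h1 : (S ∪ Q)ᶜ.card + ((S \ Q).card + Q.card) ≡
        (S' ∪ Q)ᶜ.card + ((S' \ Q).card + Q.card) [MOD choosePeriod m s] := by
      rw [hc', hc']
    exact Nat.ModEq.add_right_cancel (ha.add_right _) h1
  rw [expand S rfl, expand S' hSQ.symm]
  refine Finset.sum_congr rfl fun X _ => Finset.sum_congr rfl fun i hi => ?_
  rw [choose_cast_eq_of_modEq hm (by simpa [Nat.lt_succ_iff] using hi) ha]
  congr 1
  refine Finset.sum_congr rfl fun j hj => ?_
  rw [choose_cast_eq_of_modEq hm (by simpa [Nat.lt_succ_iff] using hj) hb]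

/-! ### Binomial inequalities -/

theorem Nat.choose_le_choose_of_le_half {n i j : ℕ} (hij : i ≤ j) (hj : 2 * j ≤ n) :
    n.choose i ≤ n.choose j := by
  induction j, hij using Nat.le_induction with
  | base => exact le_rfl
  | succ j _ ih =>
    exact (ih (by omega)).trans (Nat.choose_le_succ_of_lt_half_left (by omega))

theorem Nat.choose_le_choose_of_le_of_add_le {n t u : ℕ} (h1 : t ≤ u) (h2 : t + u ≤ n) :
    n.choose t ≤ n.choose u := by
  by_cases hu : 2 * u ≤ n
  · exact Nat.choose_le_choose_of_le_half h1 hu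
  · rw [← Nat.choose_symm (show u ≤ n by omega)]
    exact Nat.choose_le_choose_of_le_half (by omega) (by omega)

/-- Four applications of Pascal's rule give coefficients $1,4,6,4,1$; the last binomial coefficient
is at most three times $\binom{n}{u+3}$, and $1+4+6+4+3=18$. -/
theorem choose_add_four_le {n u : ℕ} (h1 : n ≤ 4 * (u + 3)) (h2 : 2 * (u + 3) ≤ n) :
    (n + 4).choose (u + 4) ≤ 18 * n.choose (u + 3) := by
  have h3 : n.choose (u + 4) ≤ 3 * n.choose (u + 3) := by
    have h4 := Nat.choose_succ_right_eq n (u + 3)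
    have h5 : n - (u + 3) ≤ 3 * (u + 3 + 1) := by omega
    refine Nat.le_of_mul_le_mul_right (c := u + 3 + 1) ?_ (by omega)
    rw [h4, mul_comm 3, mul_assoc]
    exact Nat.mul_le_mul_left _ h5
  have a1 : n.choose (u + 2) ≤ n.choose (u + 3) := Nat.choose_le_choose_of_le_half (by omega) h2
  have a2 : n.choose (u + 1) ≤ n.choose (u + 3) := Nat.choose_le_choose_of_le_half (by omega) h2
  have a3 : n.choose u ≤ n.choose (u + 3) := Nat.choose_le_choose_of_le_half (by omega) h2
  simp only [Nat.choose_succ_succ', Nat.add_assoc, Nat.reduceAdd]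
  omega

/-- Induction in steps of two, because the halved argument of the factorial then grows by exactly
$3$. The left side gains at most $18^2=324$, the right side at least $6\cdot7\cdot8=336$. -/
theorem choose_le_factorial_aux (r : ℕ) (hr1 : 1 ≤ r) (hr4 : r ≤ 4) (q : ℕ) :
    (4 * (q + 2) + r).choose (q + 3) ≤ ((3 * (q + 2) + 3 + r) / 2).factorial := by
  induction q using Nat.strong_induction_on with
  | _ q ih =>
    match q with
    | 0 => interval_cases r <;> decide
    | 1 => interval_cases r <;> decide
    | q + 2 =>
      have h1 := ih q (by omega)
      have h2 : (4 * (q + 3) + r).choose (q + 4) ≤ 18 * (4 * (q + 2) + r).choose (q + 3) := by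
        rw [show 4 * (q + 3) + r = 4 * (q + 2) + r + 4 by ring]
        exact choose_add_four_le (n := 4 * (q + 2) + r) (u := q) (by omega) (by omega)
      have h3 : (4 * (q + 4) + r).choose (q + 5) ≤ 18 * (4 * (q + 3) + r).choose (q + 4) := by
        rw [show 4 * (q + 4) + r = 4 * (q + 3) + r + 4 by ring]
        exact choose_add_four_le (n := 4 * (q + 3) + r) (u := q + 1) (by omega) (by omega)
      have h4 : (3 * (q + 2 + 2) + 3 + r) / 2 = (3 * (q + 2) + 3 + r) / 2 + 3 := by omega
      have h5 : 5 ≤ (3 * (q + 2) + 3 + r) / 2 := by omega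
      rw [h4]
      generalize (3 * (q + 2) + 3 + r) / 2 = f at *
      have h6 : 18 * 18 * f.factorial ≤ (f + 3).factorial := by
        simp only [Nat.factorial_succ]
        have : 18 * 18 ≤ (f + 2 + 1) * ((f + 1 + 1) * (f + 1)) :=
          (show 18 * 18 ≤ (5 + 2 + 1) * ((5 + 1 + 1) * (5 + 1)) by norm_num).trans (by gcongr)
        calc _ ≤ (f + 2 + 1) * ((f + 1 + 1) * (f + 1)) * f.factorial := Nat.mul_le_mul_right _ this
          _ = _ := by ring
      show (4 * (q + 4) + r).choose (q + 5) ≤ _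
      omega

theorem choose_le_factorial {n t w : ℕ} (hn : 9 ≤ n) (ht : 4 * t ≤ n + 3)
    (hw : n + 3 ≤ w + (n + 3) / 4) : n.choose t ≤ ((w + 1) / 2).factorial := by
  have h := choose_le_factorial_aux (n - 4 * ((n - 1) / 4)) (by omega) (by omega) ((n - 1) / 4 - 2)
  have e1 : 4 * ((n - 1) / 4 - 2 + 2) + (n - 4 * ((n - 1) / 4)) = n := by omega
  rw [e1] at h
  refine (Nat.choose_le_choose_of_le_half (by omega) (by omega)).trans
    (h.trans (Nat.factorial_le (by omega)))

/-- There are at least $3^j$ partitions of $(j+1)a$ points into blocks of size $a$: one more block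
multiplies the number by $\binom{(j+2)a-1}{a-1}\ge (j+2)a-1\ge3$. -/
theorem three_pow_mul_factorial_le (a : ℕ) (ha : 2 ≤ a) (j : ℕ) :
    3 ^ j * (j + 1).factorial * a.factorial ^ (j + 1) ≤ ((j + 1) * a).factorial := by
  induction j with
  | zero => simp
  | succ j ih =>
    have h1 := Nat.add_choose_mul_factorial_mul_factorial ((j + 1) * a) a
    have h2 : 3 * (j + 2) ≤ ((j + 1) * a + a).choose a := by
      have h3 := Nat.add_one_mul_choose_eq ((j + 1) * a + a - 1) (a - 1)
      rw [Nat.sub_add_cancel (by omega), Nat.sub_add_cancel (by omega)] at h3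
      have h4 : (j + 1) * a + a - 1 ≤ ((j + 1) * a + a - 1).choose (a - 1) := by
        have h6 := Nat.choose_le_choose_of_le_of_add_le (n := (j + 1) * a + a - 1) (t := 1)
          (u := a - 1) (by omega) (by
            have : 1 * a ≤ (j + 1) * a := Nat.mul_le_mul_right _ (by omega)
            omega)
        simpa using h6
      have h5 : 3 ≤ (j + 1) * a + a - 1 := by
        have : 1 * 2 ≤ (j + 1) * a := Nat.mul_le_mul (by omega) ha
        omega
      refine Nat.le_of_mul_le_mul_right (c := a) ?_ (by omega)
      rw [← h3, show (j + 1) * a + a = (j + 2) * a by ring,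
        show 3 * (j + 2) * a = (j + 2) * a * 3 by ring]
      refine Nat.mul_le_mul_left _ (h5.trans ?_)
      rwa [show (j + 2) * a = (j + 1) * a + a by ring]
    calc 3 ^ (j + 1) * (j + 1 + 1).factorial * a.factorial ^ (j + 1 + 1)
        = 3 * (j + 2) * (3 ^ j * (j + 1).factorial * a.factorial ^ (j + 1)) * a.factorial := by
          rw [Nat.factorial_succ (j + 1)]; ring
      _ ≤ ((j + 1) * a + a).choose a * ((j + 1) * a).factorial * a.factorial := by gcongr
      _ = _ := by rw [h1]; congr 1; ring

theorem choose_half_le_three_pow {e : ℕ} (he : 3 ≤ e) : e.choose (e / 2) ≤ 3 ^ (e - 2) := by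
  by_cases h6 : e < 6
  · interval_cases e <;> decide
  · refine (Nat.choose_le_two_pow _ _).trans ?_
    obtain ⟨f, rfl⟩ := Nat.exists_eq_add_of_le (not_lt.1 h6)
    rw [show 6 + f - 2 = 4 + f by omega, pow_add, pow_add]
    exact Nat.mul_le_mul (by norm_num) (Nat.pow_le_pow_left (by norm_num) _)

/-- Two steps up from $q=\lfloor(2a+3)/4\rfloor$ the binomial coefficient grows by the factor
$(2a-q)(2a-q-1)/((q+1)(q+2))$, which is at least $2$ when $a\ge5$. -/
theorem two_mul_choose_le_centralBinom {a t : ℕ} (ha : 4 ≤ a) (ht : 4 * t ≤ 2 * a + 3) :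
    2 * (2 * a).choose t ≤ (2 * a).choose a := by
  rcases ha.eq_or_lt with rfl | ha
  · have : t ≤ 2 := by omega
    interval_cases t <;> decide
  have h1 : (2 * a).choose t ≤ (2 * a).choose ((2 * a + 3) / 4) :=
    Nat.choose_le_choose_of_le_half (by omega) (by omega)
  obtain ⟨q, hq⟩ : ∃ q, q = (2 * a + 3) / 4 := ⟨_, rfl⟩
  rw [← hq] at h1
  have h2 : (2 * a).choose (q + 2) ≤ (2 * a).choose a :=
    Nat.choose_le_choose_of_le_half (by omega) le_rfl
  have h3 := Nat.choose_succ_right_eq (2 * a) q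
  have h4 := Nat.choose_succ_right_eq (2 * a) (q + 1)
  obtain ⟨x, hx⟩ : ∃ x, 2 * a = x + (q + 1) := ⟨2 * a - (q + 1), by omega⟩
  have h5 : 2 * ((q + 1) * (q + 2)) ≤ (x + 1) * x := by
    by_cases hq4 : q < 4
    · interval_cases q <;> first | omega | nlinarith
    · have : 3 * q ≤ x + 4 := by omega
      nlinarith
  have h6 : (2 * a).choose (q + 2) * ((q + 1) * (q + 2)) = (2 * a).choose q * ((x + 1) * x) := by
    have e1 : 2 * a - q = x + 1 := by omega
    have e2 : 2 * a - (q + 1) = x := by omega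
    rw [e1] at h3
    rw [e2] at h4
    calc _ = (2 * a).choose (q + 1 + 1) * (q + 1 + 1) * (q + 1) := by ring
      _ = (2 * a).choose (q + 1) * (q + 1) * x := by rw [h4]; ring
      _ = _ := by rw [h3]; ring
  have h7 : 2 * (2 * a).choose q ≤ (2 * a).choose (q + 2) := by
    refine Nat.le_of_mul_le_mul_right (c := (q + 1) * (q + 2)) ?_ (by positivity)
    rw [h6]
    calc _ = (2 * a).choose q * (2 * ((q + 1) * (q + 2))) := by ring
      _ ≤ _ := Nat.mul_le_mul_left _ h5
  omega

/-- For $e\ge3$ the blocks are split into two nearly equal groups, which also splits $e!$ at the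
cost of $\binom{e}{\lfloor e/2\rfloor}\le3^{e-2}$. The powers of three from
`three_pow_mul_factorial_le` on the two groups pay for this. The case $e=2$ needs the separate
central estimate. -/
theorem wreath_card_mul_choose_le {e a t : ℕ} (he : 2 ≤ e) (ha : 2 ≤ a) (h7 : 7 ≤ e * a)
    (ht : 4 * t ≤ e * a + 3) :
    e.factorial * a.factorial ^ e * (e * a).choose t ≤ (e * a).factorial := by
  rcases he.eq_or_lt with rfl | he
  · have h1 := two_mul_choose_le_centralBinom (a := a) (t := t) (by omega) ht
    have h2 := Nat.add_choose_mul_factorial_mul_factorial a a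
    rw [← two_mul] at h2
    calc _ = 2 * (2 * a).choose t * a.factorial * a.factorial := by
          rw [Nat.factorial_two]; ring
      _ ≤ _ := by rw [← h2]; gcongr
  · obtain ⟨j, hj⟩ : ∃ j, e / 2 = j + 1 := ⟨e / 2 - 1, by omega⟩
    obtain ⟨i, hi⟩ : ∃ i, e = (j + 1) + (i + 1) := ⟨e - (j + 1) - 1, by omega⟩
    have h1 := three_pow_mul_factorial_le a ha j
    have h2 := three_pow_mul_factorial_le a ha i
    have h3 := choose_half_le_three_pow he
    have hji : (j + 1) * a ≤ (i + 1) * a := Nat.mul_le_mul_right _ (by omega)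
    have hea : e * a = (j + 1) * a + (i + 1) * a := by rw [hi]; ring
    have h4 : t ≤ (j + 1) * a := by
      have : e * a + 3 ≤ 4 * ((j + 1) * a) := by
        by_cases he4 : e = 3
        · subst he4
          have : j = 0 := by omega
          subst this
          omega
        · have h5 : e + 2 ≤ 4 * (j + 1) := by omega
          nlinarith
      omega
    have h5 : (e * a).choose t ≤ (e * a).choose ((j + 1) * a) :=
      Nat.choose_le_choose_of_le_half h4 (by omega)
    have h6 := Nat.add_choose_mul_factorial_mul_factorial ((i + 1) * a) ((j + 1) * a)
    have h8 := Nat.add_choose_mul_factorial_mul_factorial (i + 1) (j + 1)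
    rw [add_comm, ← hea] at h6
    rw [add_comm, ← hi] at h8
    rw [hj, show e - 2 = i + j by omega] at h3
    calc e.factorial * a.factorial ^ e * (e * a).choose t
        = e.choose (j + 1) * ((i + 1).factorial * (j + 1).factorial *
          (a.factorial ^ (i + 1) * a.factorial ^ (j + 1))) * (e * a).choose t := by
          rw [← h8, ← pow_add, show i + 1 + (j + 1) = e by omega]; ring
      _ ≤ 3 ^ (i + j) * ((i + 1).factorial * (j + 1).factorial *
          (a.factorial ^ (i + 1) * a.factorial ^ (j + 1))) * (e * a).choose ((j + 1) * a) := by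
          gcongr
      _ = (e * a).choose ((j + 1) * a) * (3 ^ i * (i + 1).factorial * a.factorial ^ (i + 1)) *
          (3 ^ j * (j + 1).factorial * a.factorial ^ (j + 1)) := by rw [pow_add]; ring
      _ ≤ (e * a).choose ((j + 1) * a) * ((i + 1) * a).factorial * ((j + 1) * a).factorial := by
          gcongr
      _ = _ := h6

/-- The $d$ leftover points are split off by $\binom nt\le\binom nd\binom{n-d}{t-d}$, which reduces
to the wreath product on the other $ea$ points. -/
theorem imprimitive_card_mul_choose_le {n e a d t : ℕ} (hn : 9 ≤ n) (ht : 4 * t ≤ n + 3)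
    (he : 2 ≤ e) (ha : 2 ≤ a) (hd : d < t) (h : e * a + d = n) :
    e.factorial * a.factorial ^ e * d.factorial * n.choose t ≤ n.factorial := by
  have h1 := Nat.choose_mul (n := n) hd.le
  have h2 : n.choose t ≤ n.choose d * (e * a).choose (t - d) := by
    rw [show n - d = e * a by omega] at h1
    rw [← h1]
    exact Nat.le_mul_of_pos_right _ (Nat.choose_pos hd.le)
  have h3 := wreath_card_mul_choose_le (t := t - d) he ha (by omega) (by omega)
  have h4 := Nat.add_choose_mul_factorial_mul_factorial (e * a) d
  rw [h] at h4
  calc _ ≤ e.factorial * a.factorial ^ e * d.factorial *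
        (n.choose d * (e * a).choose (t - d)) := Nat.mul_le_mul_left _ h2
    _ = n.choose d * (e.factorial * a.factorial ^ e * (e * a).choose (t - d)) * d.factorial := by
      ring
    _ ≤ n.choose d * (e * a).factorial * d.factorial := by gcongr
    _ = _ := h4

/-! ### Subgroups of small index in a symmetric group -/

open Equiv in
/-- The three-cycle `a ↦ b ↦ c ↦ a` (if `a`, `b`, `c` are distinct). -/
def threeCycle {β : Type*} [DecidableEq β] (a b c : β) : Equiv.Perm β := swap a b * swap b c

/-! ### Three-cycles in a permutation group and the equivalence relation they generate -/

section ThreeCycle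

variable {β : Type*} [DecidableEq β]

theorem threeCycle_conj (g : Equiv.Perm β) (a b c : β) :
    threeCycle (g a) (g b) (g c) = g * threeCycle a b c * g⁻¹ := by
  simp [threeCycle, Equiv.swap_apply_apply, mul_assoc]

theorem threeCycle_inv (a b c : β) : (threeCycle a b c)⁻¹ = threeCycle c b a := by
  simp [threeCycle, Equiv.swap_comm]

theorem threeCycle_rotate {a b c : β} (h2 : b ≠ c) (h3 : a ≠ c) :
    threeCycle c a b = threeCycle a b c := by
  ext x
  simp only [threeCycle, Equiv.Perm.mul_apply, Equiv.swap_apply_def]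
  grind

theorem threeCycle_apply_fst {a b c : β} (h2 : a ≠ b) (h3 : a ≠ c) : threeCycle a b c a = b := by
  simp [threeCycle, Equiv.swap_apply_of_ne_of_ne h2 h3]

theorem threeCycle_apply_trd (a b c : β) : threeCycle a b c c = a := by
  simp [threeCycle]

theorem threeCycle_apply_of_ne {a b c x : β} (h1 : x ≠ a) (h2 : x ≠ b) (h3 : x ≠ c) :
    threeCycle a b c x = x := by
  simp [threeCycle, Equiv.swap_apply_of_ne_of_ne h2 h3, Equiv.swap_apply_of_ne_of_ne h1 h2]

variable {G : Subgroup (Equiv.Perm β)}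

theorem threeCycle_mem_conj {g : Equiv.Perm β} (hg : g ∈ G) {a b c : β}
    (h : threeCycle a b c ∈ G) : threeCycle (g a) (g b) (g c) ∈ G := by
  rw [threeCycle_conj]
  exact G.mul_mem (G.mul_mem hg h) (G.inv_mem hg)

theorem threeCycle_mem_reverse {a b c : β} (h : threeCycle a b c ∈ G) : threeCycle c b a ∈ G := by
  rw [← threeCycle_inv]
  exact G.inv_mem h

/-- Conjugating one three-cycle by another moves its third point. In the generic case $(a\,c\,e)$ is
first conjugated to $(d\,c\,e)$, which then carries $(a\,b\,d)$ to $(a\,b\,c)$. This gives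
transitivity of `threeCycleRel` and all three-cycles on a class. -/
theorem threeCycle_mem_of_common {a b c d e : β} (hab : a ≠ b) (hac : a ≠ c) (hbc : b ≠ c)
    (hda : d ≠ a) (hdb : d ≠ b) (hea : e ≠ a)
    (h1 : threeCycle a b d ∈ G) (h2 : threeCycle a c e ∈ G) : threeCycle a b c ∈ G := by
  by_cases hdc : d = c
  · rwa [← hdc]
  by_cases heb : e = b
  · rw [heb] at h2
    rw [← threeCycle_rotate hbc hac]
    have h3 := threeCycle_mem_reverse h2
    rwa [threeCycle_rotate hab hbc.symm] at h3
  by_cases hed : e = d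
  · subst hed
    have h3 := threeCycle_mem_conj h2 h1
    rw [threeCycle_apply_fst hac hea.symm, threeCycle_apply_of_ne hab.symm hbc (Ne.symm heb),
      threeCycle_apply_trd] at h3
    exact threeCycle_mem_reverse h3
  · have h3 := threeCycle_mem_conj (threeCycle_mem_reverse h1) h2
    rw [threeCycle_apply_trd, threeCycle_apply_of_ne (Ne.symm hdc) hbc.symm hac.symm,
      threeCycle_apply_of_ne hed heb hea] at h3
    have h4 := threeCycle_mem_conj h3 h1
    rwa [threeCycle_apply_of_ne hda.symm hac hea.symm,
      threeCycle_apply_of_ne hdb.symm hbc (Ne.symm heb),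
      threeCycle_apply_fst hdc (Ne.symm hed)] at h4

variable (G) in
/-- Two points are related if they are equal or lie on a common three-cycle in `G`. -/
def threeCycleRel (a b : β) : Prop :=
  a = b ∨ ∃ c, a ≠ b ∧ c ≠ a ∧ c ≠ b ∧ threeCycle a b c ∈ G

theorem threeCycleRel_symm {a b : β} (h : threeCycleRel G a b) : threeCycleRel G b a := by
  rcases h with rfl | ⟨c, hab, hca, hcb, h⟩
  · exact Or.inl rfl
  · refine Or.inr ⟨c, hab.symm, hcb, hca, ?_⟩
    rw [← threeCycle_rotate hca.symm hcb.symm]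
    exact threeCycle_mem_reverse h

theorem threeCycle_mem_of_rel {a b c : β} (hab : a ≠ b) (hac : a ≠ c) (hbc : b ≠ c)
    (h1 : threeCycleRel G a b) (h2 : threeCycleRel G a c) : threeCycle a b c ∈ G := by
  rcases h1 with h1 | ⟨d, _, hda, hdb, h1⟩
  · exact absurd h1 hab
  rcases h2 with h2 | ⟨e, _, hea, _, h2⟩
  · exact absurd h2 hac
  exact threeCycle_mem_of_common hab hac hbc hda hdb hea h1 h2

theorem threeCycleRel_trans {a b c : β} (h1 : threeCycleRel G a b) (h2 : threeCycleRel G b c) :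
    threeCycleRel G a c := by
  by_cases hab : a = b
  · rwa [hab]
  by_cases hbc : b = c
  · rwa [← hbc]
  by_cases hac : a = c
  · exact Or.inl hac
  refine Or.inr ⟨b, hac, Ne.symm hab, hbc, ?_⟩
  have h3 := threeCycle_mem_of_rel (Ne.symm hab) hbc hac (threeCycleRel_symm h1) h2
  rwa [threeCycle_rotate (Ne.symm hbc) hab] at h3

theorem threeCycleRel_map_iff {G' : Subgroup (Equiv.Perm β)} {π : Equiv.Perm β}
    (h : ∀ x, π * x * π⁻¹ ∈ G' ↔ x ∈ G) (a b : β) :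
    threeCycleRel G' (π a) (π b) ↔ threeCycleRel G a b := by
  refine or_congr π.injective.eq_iff (π.surjective.exists.trans (exists_congr fun c => ?_))
  simp only [threeCycle_conj, h, ne_eq, EmbeddingLike.apply_eq_iff_eq]

theorem threeCycleRel_apply_iff {g : Equiv.Perm β} (hg : g ∈ G) (a b : β) :
    threeCycleRel G (g a) (g b) ↔ threeCycleRel G a b :=
  threeCycleRel_map_iff (fun x => by
    rw [G.mul_mem_cancel_right (G.inv_mem hg), G.mul_mem_cancel_left hg]) a b

/-- A subgroup that contains all three-cycles on `A` contains all even permutations of `A`. -/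
theorem even_perm_mem_of_threeCycles [Fintype β] {A : Finset β}
    (hA : ∀ a ∈ A, ∀ b ∈ A, ∀ c ∈ A, a ≠ b → a ≠ c → b ≠ c → threeCycle a b c ∈ G)
    {π : Equiv.Perm β} (hπ : Equiv.Perm.sign π = 1) (hfix : ∀ b, b ∉ A → π b = b) : π ∈ G := by
  have hA' : ∀ x, π x ∈ A ↔ x ∈ A := by
    intro x
    constructor
    · intro hx
      by_contra hxA
      exact hxA (hfix x hxA ▸ hx)
    · intro hx
      by_contra hxA
      exact hxA ((π.injective (hfix _ hxA)).symm ▸ hx)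
  have h1 : Equiv.Perm.ofSubtype (π.subtypePerm hA') = π :=
    Equiv.Perm.ofSubtype_subtypePerm hA' fun x hx => by
      by_contra hxA
      exact hx (hfix x hxA)
  have h2 : π.subtypePerm hA' ∈ alternatingGroup {x // x ∈ A} := by
    rw [Equiv.Perm.mem_alternatingGroup, ← Equiv.Perm.sign_ofSubtype, h1, hπ]
  rw [← Equiv.Perm.closure_three_cycles_eq_alternating] at h2
  have h3 : Subgroup.closure {σ : Equiv.Perm {x // x ∈ A} | σ.IsThreeCycle} ≤
      G.comap Equiv.Perm.ofSubtype := by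
    rw [Subgroup.closure_le]
    intro σ hσ
    obtain ⟨a, ha⟩ : σ.support.Nonempty := by
      rw [← Finset.card_pos, Equiv.Perm.IsThreeCycle.card_support hσ]
      norm_num
    have h4 := (Equiv.Perm.IsThreeCycle.eq_swap_mul_swap_iff_mem_support hσ).2 ha
    have h5 := (Equiv.Perm.IsThreeCycle.nodup_iff_mem_support hσ).2 ha
    simp only [List.nodup_cons, List.mem_cons, List.not_mem_nil, or_false, not_or] at h5
    rw [SetLike.mem_coe, Subgroup.mem_comap, h4, map_mul, Equiv.Perm.ofSubtype_swap_eq,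
      Equiv.Perm.ofSubtype_swap_eq]
    exact hA _ a.2 _ (σ a).2 _ (σ (σ a)).2 (fun h => h5.1.1 (Subtype.ext h))
      (fun h => h5.1.2 (Subtype.ext h)) (fun h => h5.2.1 (Subtype.ext h))
  rw [← h1]
  exact h3 h2

end ThreeCycle

theorem card_mul_index_eq_factorial {β : Type*} [Fintype β] (G : Subgroup (Equiv.Perm β)) :
    Nat.card G * G.index = (Fintype.card β).factorial := by
  rw [Subgroup.card_mul_index, Nat.card_perm, Nat.card_eq_fintype_card]

/-! ### Lower bounds for the index of a subgroup -/

section Index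

variable {β : Type*} [Fintype β] [DecidableEq β] (G : Subgroup (Equiv.Perm β))

/-- Distinct permutations of $\Gamma$ lie in distinct cosets of $G$, as their quotient is supported
on $\Gamma$. -/
theorem factorial_card_le_index {Γ : Finset β}
    (hΓ : ∀ g ∈ G, (∀ x, x ∉ Γ → g x = x) → g = 1) : Γ.card.factorial ≤ G.index := by
  have h1 : Nat.card (Equiv.Perm {x // x ∈ Γ}) = Γ.card.factorial := by
    rw [Nat.card_perm, Nat.card_eq_fintype_card, Fintype.card_coe]
  rw [← h1, Subgroup.index]
  refine Nat.card_le_card_of_injective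
    (fun σ => (QuotientGroup.mk (Equiv.Perm.ofSubtype σ) : Equiv.Perm β ⧸ G)) fun σ τ h => ?_
  have h2 := hΓ _ (QuotientGroup.eq.1 h) fun x hx => by
    rw [← map_inv, ← map_mul, Equiv.Perm.ofSubtype_apply_of_not_mem _ hx]
  rw [inv_mul_eq_one] at h2
  exact Equiv.Perm.ofSubtype_injective h2

/-- Bochert's argument: if `G` has no three-cycles on `W`, then its index is large. -/
theorem factorial_half_le_index {W : Finset β}
    (hW : ∀ a ∈ W, ∀ b ∈ W, ∀ c ∈ W, a ≠ b → a ≠ c → b ≠ c → threeCycle a b c ∉ G) :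
    ((W.card + 1) / 2).factorial ≤ G.index := by
  classical
  let P : Finset β → Prop := fun Γ => ∀ g ∈ G, (∀ x, x ∉ Γ → g x = x) → g = 1
  obtain ⟨Γ, hΓ, hmax⟩ := Finset.exists_max_image (W.powerset.filter P) Finset.card
    ⟨∅, Finset.mem_filter.2 ⟨Finset.empty_mem_powerset _,
      fun g _ hg => Equiv.ext fun x => hg x (by simp)⟩⟩
  simp only [Finset.mem_filter, Finset.mem_powerset] at hΓ hmax
  -- $\Gamma\subseteq W$ is largest among the sets supporting no nontrivial element of $G$. If it
  -- had fewer than half of the points, $W\setminus\Gamma$ would be larger, hence would support some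
  -- $x\ne1$ in $G$; adding a point $\delta$ moved by $x$ to $\Gamma$ then yields a $y\in G$ moving
  -- $\delta$.
  refine le_trans (Nat.factorial_le ?_) (factorial_card_le_index G hΓ.2)
  by_contra hlt
  have hcard := Finset.card_sdiff_add_card_eq_card hΓ.1
  have hx : ¬ P (W \ Γ) := fun h => by
    have := hmax _ ⟨Finset.sdiff_subset, h⟩
    omega
  simp only [P, not_forall] at hx
  obtain ⟨x, hxG, hxfix, hx1⟩ := hx
  obtain ⟨δ, hδ⟩ : ∃ δ, x δ ≠ δ := by
    by_contra! h
    exact hx1 (Equiv.ext h)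
  have hδW : δ ∈ W \ Γ := by
    by_contra h
    exact hδ (hxfix δ h)
  rw [Finset.mem_sdiff] at hδW
  have hy : ¬ P (insert δ Γ) := fun h => by
    have := hmax _ ⟨Finset.insert_subset hδW.1 hΓ.1, h⟩
    rw [Finset.card_insert_of_notMem hδW.2] at this
    omega
  simp only [P, not_forall] at hy
  obtain ⟨y, hyG, hyfix, hy1⟩ := hy
  have hyδ : y δ ≠ δ := fun h => hy1 (hΓ.2 y hyG fun b hb => by
    by_cases hbδ : b = δ
    · rw [hbδ, h]
    · exact hyfix b (by simp [hb, hbδ]))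
  have hyΓ : y δ ∈ Γ := by
    by_contra h
    exact hyδ (y.injective (hyfix (y δ) (by simp [h, hyδ])))
  have hxδ : x⁻¹ δ ≠ δ := fun h => hδ (by
    rw [Equiv.Perm.inv_eq_iff_eq] at h
    exact h.symm)
  have hxW : x⁻¹ δ ∈ W \ Γ := by
    by_contra h
    have h' := hxfix _ h
    have h'' : x (x⁻¹ δ) = δ := x.apply_symm_apply δ
    exact hxδ (h'.symm.trans h'')
  rw [Finset.mem_sdiff] at hxW
  have hxy : x (y δ) = y δ := hxfix _ (by simp [hyΓ])
  have hxy' : x⁻¹ (y δ) = y δ := by rw [Equiv.Perm.inv_eq_iff_eq, hxy]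
  have hdisj : Equiv.Perm.Disjoint (Equiv.swap δ (y δ) * y) x := by
    intro b
    by_cases hb : b ∈ Γ
    · exact Or.inr (hxfix b (by simp [hb]))
    · left
      by_cases hbδ : b = δ
      · simp [hbδ]
      · rw [Equiv.Perm.mul_apply, hyfix b (by simp [hb, hbδ]),
          Equiv.swap_apply_of_ne_of_ne hbδ (fun h => hb (h ▸ hyΓ))]
  -- The supports of $x$ and $y$ meet only in $\delta$. Thus $y$ is the transposition
  -- $(\delta\;y\delta)$ times a permutation commuting with $x$, and the commutator below is a
  -- three-cycle on $W$.
  have hcomm : y * x * y⁻¹ = Equiv.swap δ (y δ) * x * Equiv.swap δ (y δ) := by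
    have h := hdisj.commute.eq
    have h' : y = Equiv.swap δ (y δ) * (Equiv.swap δ (y δ) * y) := by
      rw [← mul_assoc, Equiv.swap_mul_self, one_mul]
    calc y * x * y⁻¹ = Equiv.swap δ (y δ) * (Equiv.swap δ (y δ) * y * x) * y⁻¹ := by
          rw [← mul_assoc, ← mul_assoc, Equiv.swap_mul_self, one_mul]
      _ = _ := by rw [h]; simp [mul_assoc]
  have hmem : x⁻¹ * (y * x * y⁻¹) ∈ G :=
    G.mul_mem (G.inv_mem hxG) (G.mul_mem (G.mul_mem hyG hxG) (G.inv_mem hyG))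
  have hcyc : x⁻¹ * (y * x * y⁻¹) = threeCycle (x⁻¹ δ) (y δ) δ := by
    have h := Equiv.swap_apply_apply x⁻¹ δ (y δ)
    rw [hxy', inv_inv] at h
    rw [hcomm, threeCycle, h, Equiv.swap_comm (y δ) δ]
    simp only [mul_assoc]
  rw [hcyc] at hmem
  exact hW _ hxW.1 _ (hΓ.1 hyΓ) _ hδW.1 (fun h => hxW.2 (h ▸ hyΓ)) hxδ
    (fun h => hδW.2 (h ▸ hyΓ)) hmem

/-- $G$ embeds into the product of the symmetric groups on $U$ and its complement. -/
theorem choose_card_le_index {U : Finset β} (hU : ∀ g ∈ G, ∀ b, g b ∈ U ↔ b ∈ U) :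
    (Fintype.card β).choose U.card ≤ G.index := by
  have h1 : Nat.card G ≤ U.card.factorial * (Fintype.card β - U.card).factorial := by
    have h2 : Nat.card (Equiv.Perm {x // x ∈ U} × Equiv.Perm {x // x ∉ U}) =
        U.card.factorial * (Fintype.card β - U.card).factorial := by
      simp [Fintype.card_perm, Fintype.card_subtype_compl]
    rw [← h2]
    refine Nat.card_le_card_of_injective (fun g : G => (g.1.subtypePerm (hU g.1 g.2),
      g.1.subtypePerm fun b => not_congr (hU g.1 g.2 b))) fun g g' h => ?_
    rw [Prod.mk.injEq] at h
    ext b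
    by_cases hb : b ∈ U
    · simpa using congrArg Subtype.val (Equiv.congr_fun h.1 ⟨b, hb⟩)
    · simpa using congrArg Subtype.val (Equiv.congr_fun h.2 ⟨b, hb⟩)
  have h3 := Nat.choose_mul_factorial_mul_factorial (Finset.card_le_univ U)
  have h4 := card_mul_index_eq_factorial G
  refine Nat.le_of_mul_le_mul_right
    (c := U.card.factorial * (Fintype.card β - U.card).factorial) ?_ (by positivity)
  rw [← mul_assoc, h3, ← h4, mul_comm]
  exact Nat.mul_le_mul_left _ h1

/-- Such a permutation is determined by its action on the $e$ fibres and by one permutation of `Fin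
a` for each fibre. -/
theorem card_blockPreserving_le (e a : ℕ) (ha : 0 < a) :
    Nat.card {σ : Equiv.Perm (Fin e × Fin a) // ∀ p q, p.1 = q.1 → (σ p).1 = (σ q).1} ≤
      e.factorial * a.factorial ^ e := by
  have h1 : Nat.card (Equiv.Perm (Fin e) × (Fin e → Equiv.Perm (Fin a))) =
      e.factorial * a.factorial ^ e := by
    simp [Fintype.card_perm]
  rw [← h1]
  have hf : ∀ σ : {σ : Equiv.Perm (Fin e × Fin a) // ∀ p q, p.1 = q.1 → (σ p).1 = (σ q).1},
      Function.Bijective fun i => (σ.1 (i, ⟨0, ha⟩)).1 := by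
    intro σ
    refine (Finite.surjective_iff_bijective).1 fun i => ?_
    exact ⟨(σ.1.symm (i, ⟨0, ha⟩)).1, (σ.2 (_, ⟨0, ha⟩) (σ.1.symm (i, ⟨0, ha⟩)) rfl).trans (by
      rw [Equiv.apply_symm_apply])⟩
  have hg : ∀ σ : {σ : Equiv.Perm (Fin e × Fin a) // ∀ p q, p.1 = q.1 → (σ p).1 = (σ q).1},
      ∀ i, Function.Bijective fun j => (σ.1 (i, j)).2 := by
    intro σ i
    refine (Finite.injective_iff_bijective).1 fun j j' h => ?_
    have h2 : (i, j) = (i, j') := σ.1.injective (Prod.ext (σ.2 _ _ rfl) h)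
    exact (Prod.mk.inj h2).2
  refine Nat.card_le_card_of_injective
    (fun σ => (Equiv.ofBijective _ (hf σ), fun i => Equiv.ofBijective _ (hg σ i))) fun σ τ h => ?_
  rw [Prod.mk.injEq] at h
  refine Subtype.ext (Equiv.ext fun p => Prod.ext ?_ ?_)
  · rw [σ.2 p (p.1, ⟨0, ha⟩) rfl, τ.2 p (p.1, ⟨0, ha⟩) rfl]
    exact Equiv.congr_fun h.1 p.1
  · exact Equiv.congr_fun (congrFun h.2 p.1) p.2

theorem exists_equiv_prod_of_card_fiber {α ι : Type*} [Fintype α] [DecidableEq ι] (f : α → ι)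
    (a : ℕ) (hf : ∀ x, Fintype.card {y // f y = f x} = a) :
    ∃ (e : ℕ) (φ : α ≃ Fin e × Fin a), ∀ x y, (φ x).1 = (φ y).1 ↔ f x = f y := by
  let F : α → Set.range f := fun x => ⟨f x, x, rfl⟩
  have hF : ∀ y : Set.range f, Nonempty ({x // F x = y} ≃ Fin a) := by
    rintro ⟨_, x, rfl⟩
    refine ⟨(Equiv.subtypeEquivRight fun y => ?_).trans (Fintype.equivFinOfCardEq (hf x))⟩
    exact Subtype.ext_iff
  have : Fintype (Set.range f) := Fintype.ofFinite _
  let φ : α ≃ Fin (Fintype.card (Set.range f)) × Fin a :=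
    (Equiv.sigmaFiberEquiv F).symm.trans ((Equiv.sigmaCongrRight fun y => (hF y).some).trans
      ((Equiv.sigmaEquivProd _ _).trans
        (Equiv.prodCongr (Fintype.equivFin _) (Equiv.refl _))))
  have hφ : ∀ x, (φ x).1 = Fintype.equivFin _ (F x) := fun x => rfl
  refine ⟨_, φ, fun x y => ?_⟩
  rw [hφ, hφ, EmbeddingLike.apply_eq_iff_eq]
  exact Subtype.ext_iff

theorem card_le_of_blockPreserving {U : Finset β} (hU : ∀ g ∈ G, ∀ b, g b ∈ U ↔ b ∈ U)
    {e a : ℕ} (ha : 0 < a) (φ : {x // x ∈ U} ≃ Fin e × Fin a)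
    (hφ : ∀ g (hg : g ∈ G), ∀ x y : {x // x ∈ U}, (φ x).1 = (φ y).1 →
      (φ ⟨g x, (hU g hg x).2 x.2⟩).1 = (φ ⟨g y, (hU g hg y).2 y.2⟩).1) :
    Nat.card G ≤ e.factorial * a.factorial ^ e * (Fintype.card β - U.card).factorial := by
  have h1 : Nat.card (Equiv.Perm {x // x ∉ U}) = (Fintype.card β - U.card).factorial := by
    simp [Fintype.card_perm, Fintype.card_subtype_compl]
  rw [← h1]
  refine le_trans ?_ (Nat.mul_le_mul_right _ (card_blockPreserving_le e a ha))
  rw [← Nat.card_prod]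
  refine Nat.card_le_card_of_injective (fun g : G =>
    ((⟨φ.permCongr (g.1.subtypePerm (hU g.1 g.2)), fun p q hpq => by
      have := hφ g.1 g.2 (φ.symm p) (φ.symm q) (by simpa using hpq)
      simpa [Equiv.permCongr_apply] using! this⟩ :
        {σ : Equiv.Perm (Fin e × Fin a) // ∀ p q, p.1 = q.1 → (σ p).1 = (σ q).1}),
      g.1.subtypePerm fun b => not_congr (hU g.1 g.2 b))) fun g g' h => ?_
  rw [Prod.mk.injEq] at h
  ext b
  by_cases hb : b ∈ U
  · have h2 := φ.permCongr.injective (Subtype.ext_iff.1 h.1)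
    simpa using congrArg Subtype.val (Equiv.congr_fun h2 ⟨b, hb⟩)
  · simpa using congrArg Subtype.val (Equiv.congr_fun h.2 ⟨b, hb⟩)

end Index

/-! ### Subgroups of small index contain a large alternating group -/

section LargeClass

variable {β : Type*} [Fintype β] [DecidableEq β] (G : Subgroup (Equiv.Perm β))

open Classical in
/-- The class of `b` with respect to `threeCycleRel G`. -/
noncomputable def threeCycleClass (b : β) : Finset β :=
  Finset.univ.filter (threeCycleRel G b)

variable {G}

theorem mem_threeCycleClass {a b : β} : a ∈ threeCycleClass G b ↔ threeCycleRel G b a := by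
  simp [threeCycleClass]

theorem threeCycleClass_eq_iff {a b : β} :
    threeCycleClass G a = threeCycleClass G b ↔ threeCycleRel G a b := by
  constructor
  · intro h
    rw [← mem_threeCycleClass, h, mem_threeCycleClass]
    exact Or.inl rfl
  · intro h
    ext c
    rw [mem_threeCycleClass, mem_threeCycleClass]
    exact ⟨threeCycleRel_trans (threeCycleRel_symm h), threeCycleRel_trans h⟩

theorem threeCycleClass_map {G' : Subgroup (Equiv.Perm β)} {π : Equiv.Perm β}
    (h : ∀ x, π * x * π⁻¹ ∈ G' ↔ x ∈ G) (b : β) :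
    threeCycleClass G' (π b) = (threeCycleClass G b).map π.toEmbedding := by
  ext c
  obtain ⟨c, rfl⟩ := π.surjective c
  rw [mem_threeCycleClass, threeCycleRel_map_iff h, ← mem_threeCycleClass]
  exact (Finset.mem_map' π.toEmbedding).symm

theorem card_threeCycleClass_apply {g : Equiv.Perm β} (hg : g ∈ G) (b : β) :
    (threeCycleClass G (g b)).card = (threeCycleClass G b).card := by
  rw [threeCycleClass_map (G := G) (fun x => by
    rw [G.mul_mem_cancel_right (G.inv_mem hg), G.mul_mem_cancel_left hg]) b, Finset.card_map]

/-- A subgroup of small index in the symmetric group has a `threeCycleRel`-class of large size. -/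
theorem exists_large_threeCycleClass {t : ℕ} (hn : 9 ≤ Fintype.card β)
    (ht : 4 * t ≤ Fintype.card β + 3) (hG : G.index < (Fintype.card β).choose t) :
    ∃ b, Fintype.card β < t + (threeCycleClass G b).card := by
  have hinv : ∀ U : Finset β, (∀ g ∈ G, ∀ b, g b ∈ U ↔ b ∈ U) →
      U.card < t ∨ Fintype.card β < t + U.card := by
    intro U hU
    by_contra! h
    have h1 := choose_card_le_index G hU
    have h2 : (Fintype.card β).choose t ≤ (Fintype.card β).choose U.card := by
      by_cases h3 : t + U.card ≤ Fintype.card β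
      · exact Nat.choose_le_choose_of_le_of_add_le h.1 h3
      · omega
    omega
  have hlevel : ∀ P : ℕ → Prop, [DecidablePred P] → ∀ U : Finset β,
      U = Finset.univ.filter (fun b => P (threeCycleClass G b).card) →
      U.card < t ∨ Fintype.card β < t + U.card := by
    rintro P _ U rfl
    refine hinv _ fun g hg b => ?_
    simp only [Finset.mem_filter, Finset.mem_univ, true_and, card_threeCycleClass_apply hg]
  -- The least such $a$ plays the role of a median class size: classes smaller than $a$ cover fewer
  -- than $t$ points and classes of size at most $a$ cover more than $N-t$. The points in classes of
  -- size exactly $a$ then cannot be fewer than $t$, so they too exceed $N-t$.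
  have hex : ∃ a, t ≤ (Finset.univ.filter fun b => (threeCycleClass G b).card ≤ a).card := by
    refine ⟨Fintype.card β, ?_⟩
    rw [Finset.filter_true_of_mem fun b _ => Finset.card_le_univ _, Finset.card_univ]
    omega
  have ha := Nat.find_spec hex
  have hmin := fun a' => Nat.find_min hex (m := a')
  generalize Nat.find hex = a at ha hmin
  obtain ⟨U, hU⟩ : ∃ U : Finset β, U = Finset.univ.filter
    fun b => (threeCycleClass G b).card = a := ⟨_, rfl⟩
  have hmemU : ∀ b, b ∈ U ↔ (threeCycleClass G b).card = a := fun b => by simp [hU]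
  have hUcard : Fintype.card β < t + U.card := by
    have h1 := hlevel (· ≤ a) _ rfl
    have h2 : (Finset.univ.filter fun b => (threeCycleClass G b).card < a).card < t := by
      rcases Nat.eq_zero_or_pos a with rfl | hpos
      · simp only [not_lt_zero, Finset.filter_false, Finset.card_empty]
        by_contra h0
        have : t = 0 := by omega
        rw [this, Nat.choose_zero_right, Nat.lt_one_iff] at hG
        exact Subgroup.index_ne_zero_of_finite hG
      · have h3 := hmin (a - 1) (by omega)
        rw [not_le] at h3
        refine lt_of_le_of_lt (Finset.card_le_card ?_) h3
        intro b
        simp only [Finset.mem_filter, Finset.mem_univ, true_and]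
        omega
    have h3 : (Finset.univ.filter fun b => (threeCycleClass G b).card ≤ a).card ≤
        (Finset.univ.filter fun b => (threeCycleClass G b).card < a).card + U.card := by
      refine le_trans (Finset.card_le_card ?_) (Finset.card_union_le _ _)
      intro b
      simp only [Finset.mem_filter, Finset.mem_univ, true_and, Finset.mem_union, hmemU]
      omega
    have h4 := hlevel (· = a) U hU
    omega
  have hUinv : ∀ g ∈ G, ∀ b, g b ∈ U ↔ b ∈ U := fun g hg b => by
    rw [hmemU, hmemU, card_threeCycleClass_apply hg]
  have hUle : U.card ≤ Fintype.card β := Finset.card_le_univ U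
  have hfib : ∀ x : {x // x ∈ U}, Fintype.card {y : {x // x ∈ U} //
      threeCycleClass G y.1 = threeCycleClass G x.1} = a := by
    intro x
    have h1 := (hmemU x).1 x.2
    rw [← h1, ← Fintype.card_coe]
    refine Fintype.card_congr
      ⟨fun y => ⟨y.1.1, mem_threeCycleClass.2 (threeCycleClass_eq_iff.1 y.2.symm)⟩,
       fun y => ⟨⟨y.1, ?_⟩, ?_⟩, fun _ => rfl, fun _ => rfl⟩
    · rw [hmemU, ← threeCycleClass_eq_iff.2 (mem_threeCycleClass.1 y.2), h1]
    · exact (threeCycleClass_eq_iff.2 (mem_threeCycleClass.1 y.2)).symm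
  obtain ⟨e, φ, hφ⟩ := exists_equiv_prod_of_card_fiber
    (fun x : {x // x ∈ U} => threeCycleClass G x.1) a hfib
  have hea : e * a = U.card := by
    have h1 := Fintype.card_congr φ
    rw [Fintype.card_coe, Fintype.card_prod, Fintype.card_fin, Fintype.card_fin] at h1
    exact h1.symm
  have hpos : 0 < e * a := by omega
  have hapos : 0 < a := Nat.pos_of_mul_pos_left hpos
  have hepos : 0 < e := Nat.pos_of_mul_pos_right hpos
  obtain ⟨b₀, hb₀⟩ : U.Nonempty := by
    rw [← Finset.card_pos]
    omega
  rcases Nat.lt_or_ge e 2 with he | he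
  · refine ⟨b₀, ?_⟩
    have : e = 1 := by omega
    rw [this, one_mul] at hea
    rw [(hmemU b₀).1 hb₀, hea]
    exact hUcard
  exfalso
  rcases Nat.lt_or_ge a 2 with ha2 | ha2
  · obtain rfl : a = 1 := by omega
    have hsingle : ∀ b ∈ U, ∀ c, threeCycleRel G b c → c = b := by
      intro b hb c hc
      obtain ⟨d, hd⟩ := Finset.card_eq_one.1 ((hmemU b).1 hb)
      have h1 : b ∈ threeCycleClass G b := mem_threeCycleClass.2 (Or.inl rfl)
      have h2 := mem_threeCycleClass.2 hc
      rw [hd, Finset.mem_singleton] at h1 h2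
      rw [h1, h2]
    -- No point of $U$ lies on a three-cycle of $G$, and two extra points create none either, so
    -- $W=U\cup V$ qualifies for Bochert's bound. When $U$ is not everything, the two points are
    -- exactly what the size condition of `choose_le_factorial` requires.
    obtain ⟨V, hVcard, hVU, hV⟩ : ∃ V : Finset β,
        Fintype.card β + 3 ≤ U.card + V.card + (Fintype.card β + 3) / 4 ∧ Disjoint U V ∧
        V.card ≤ 2 := by
      by_cases hU' : U.card = Fintype.card β
      · exact ⟨∅, by simp; omega, by simp, by simp⟩
      · obtain ⟨b, hb⟩ : ∃ b, b ∉ U := by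
          by_contra! h
          exact hU' (by rw [Finset.eq_univ_iff_forall.2 h, Finset.card_univ])
        have h1 : 1 < (threeCycleClass G b).card := by
          have h2 : (threeCycleClass G b).card ≠ 1 := fun h => hb ((hmemU b).2 h)
          have h3 : 0 < (threeCycleClass G b).card :=
            Finset.card_pos.2 ⟨b, mem_threeCycleClass.2 (Or.inl rfl)⟩
          omega
        obtain ⟨c, hc, hcb⟩ := Finset.exists_mem_ne h1 b
        rw [mem_threeCycleClass] at hc
        have hcU : c ∉ U := fun h => hcb ((hsingle c h b (threeCycleRel_symm hc)).symm)
        rcases hc with hc | ⟨d, hbc, hdb, hdc, hmem⟩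
        · exact absurd hc hcb.symm
        have hdU : d ∉ U := fun h => hdb ((hsingle d h b (Or.inr ⟨c, hdb, hdc.symm, hbc.symm, by
          rwa [threeCycle_rotate hdc.symm hdb.symm]⟩)).symm)
        have h3 : U.card + 3 ≤ Fintype.card β := by
          have h4 : ({b, c, d} : Finset β).card = 3 :=
            Finset.card_eq_three.2 ⟨b, c, d, hbc, hdb.symm, hdc.symm, rfl⟩
          have h5 : Disjoint U {b, c, d} := by
            simp [Finset.disjoint_insert_right, hb, hcU, hdU]
          rw [← h4, ← Finset.card_union_of_disjoint h5]
          exact Finset.card_le_univ _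
        refine ⟨{b, c}, ?_, by simp [Finset.disjoint_insert_right, hb, hcU], Finset.card_le_two⟩
        rw [Finset.card_pair hbc]
        omega
    have hW := factorial_half_le_index G (W := U ∪ V) (by
      intro x hx y hy z hz hxy hxz hyz hmem
      have key : ∀ x y z : β, x ≠ y → x ≠ z → y ≠ z → threeCycle x y z ∈ G → x ∉ U :=
        fun x y z hxy hxz hyz hmem hxU =>
          hxy (hsingle x hxU y (Or.inr ⟨z, hxy, hxz.symm, hyz.symm, hmem⟩)).symm
      have hxU := key x y z hxy hxz hyz hmem
      have hzU := key z x y hxz.symm hyz.symm hxy (by rwa [threeCycle_rotate hyz hxz])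
      have hyU := key y z x hyz hxy.symm hxz.symm (by
        rwa [threeCycle_rotate hxy hyz.symm, threeCycle_rotate hyz hxz])
      simp only [Finset.mem_union, hxU, hyU, hzU, false_or] at hx hy hz
      have h1 : ({x, y, z} : Finset β) ⊆ V := by
        simp [Finset.insert_subset_iff, hx, hy, hz]
      have h2 := Finset.card_le_card h1
      rw [Finset.card_eq_three.2 ⟨x, y, z, hxy, hxz, hyz, rfl⟩] at h2
      omega)
    rw [Finset.card_union_of_disjoint hVU] at hW
    have := choose_le_factorial hn ht (w := U.card + V.card) hVcard
    omega
  · have h1 := card_le_of_blockPreserving G hUinv hapos φ fun g hg x y hxy => by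
      rw [hφ] at hxy ⊢
      simp only at hxy ⊢
      rw [threeCycleClass_eq_iff] at hxy ⊢
      rwa [threeCycleRel_apply_iff hg]
    have h2 := imprimitive_card_mul_choose_le (d := Fintype.card β - U.card) hn ht he ha2
      (by omega) (by omega)
    have h3 := card_mul_index_eq_factorial G
    have h4 : 0 < Nat.card G := Nat.card_pos
    have h5 : Nat.card G * G.index < Nat.card G * (Fintype.card β).choose t :=
      Nat.mul_lt_mul_of_pos_left hG h4
    have h6 := Nat.mul_le_mul_right ((Fintype.card β).choose t) h1
    omega

variable (G) in
/-- The union of all classes with at most half of the points. -/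
noncomputable def smallClasses : Finset β :=
  Finset.univ.filter fun b => 2 * (threeCycleClass G b).card ≤ Fintype.card β

/-- The set is defined from $G$ without choosing a large class, so it is carried along by
conjugation. -/
theorem smallClasses_map {G' : Subgroup (Equiv.Perm β)} {π : Equiv.Perm β}
    (h : ∀ x, π * x * π⁻¹ ∈ G' ↔ x ∈ G) :
    smallClasses G' = (smallClasses G).map π.toEmbedding := by
  ext c
  obtain ⟨c, rfl⟩ := π.surjective c
  rw [show π c = π.toEmbedding c from rfl, Finset.mem_map']
  simp only [smallClasses, Finset.mem_filter, Finset.mem_univ, true_and, Equiv.coe_toEmbedding,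
    threeCycleClass_map h, Finset.card_map]

/-- The class with more than $N-t$ points has more than half of them, so all other classes are small
and the small points are exactly its complement. -/
theorem smallClasses_spec {t : ℕ} (hn : 9 ≤ Fintype.card β)
    (ht : 4 * t ≤ Fintype.card β + 3) (hG : G.index < (Fintype.card β).choose t) :
    (smallClasses G).card < t ∧ ∀ π : Equiv.Perm β, Equiv.Perm.sign π = 1 →
      (∀ b ∈ smallClasses G, π b = b) → π ∈ G := by
  obtain ⟨b₀, hb₀⟩ := exists_large_threeCycleClass hn ht hG
  have hc : ((threeCycleClass G b₀)ᶜ).card + (threeCycleClass G b₀).card = Fintype.card β :=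
    Finset.card_compl_add_card _
  have heq : smallClasses G = (threeCycleClass G b₀)ᶜ := by
    ext b
    simp only [smallClasses, Finset.mem_filter, Finset.mem_univ, true_and, Finset.mem_compl]
    constructor
    · intro hb hmem
      rw [← threeCycleClass_eq_iff.2 (mem_threeCycleClass.1 hmem)] at hb
      omega
    · intro hb
      have h1 : threeCycleClass G b ⊆ (threeCycleClass G b₀)ᶜ := by
        intro c hc
        rw [Finset.mem_compl]
        intro hc'
        rw [mem_threeCycleClass] at hc hc' hb
        exact hb (threeCycleRel_trans hc' (threeCycleRel_symm hc))
      have h2 := Finset.card_le_card h1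
      omega
  rw [heq]
  refine ⟨by omega, fun π hπ hfix => even_perm_mem_of_threeCycles (A := threeCycleClass G b₀) ?_ hπ
    fun b hb => hfix b (by simpa using hb)⟩
  intro a ha b hb c hc hab hac hbc
  rw [mem_threeCycleClass] at ha hb hc
  exact threeCycle_mem_of_rel hab hac hbc (threeCycleRel_trans (threeCycleRel_symm ha) hb)
    (threeCycleRel_trans (threeCycleRel_symm ha) hc)

end LargeClass

/-! ### Blocks of the tree -/

namespace TreeNode

variable {h : ℕ} {k : Fin h → ℕ}

theorem eq_of_path {u w : TreeNode k} (hl : u.level = w.level)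
    (hp : ∀ j hu hw, u.path j hu = w.path j hw) : u = w := by
  obtain ⟨lu, hlu, pu⟩ := u
  obtain ⟨lw, hlw, pw⟩ := w
  simp only at hl
  subst hl
  congr
  funext j hj
  exact hp j hj hj

theorem mem_block_iff {v w : TreeNode k} (hv : v.level < h) :
    w ∈ v.block ↔ w.level = v.level ∧
      ∀ (j : Fin h), v.level < j → ∀ hw hv, w.path j hw = v.path j hv := by
  constructor
  · rintro ⟨u, ⟨h1, h2⟩, h3, h4⟩
    refine ⟨by omega, fun j hj hw hv => ?_⟩
    rw [← h4 j (by omega) hw, ← h2 j (by omega) hv]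
  · rintro ⟨h1, h2⟩
    refine ⟨⟨v.level + 1, hv, fun j hj => v.path j (by omega)⟩, ⟨rfl, fun _ _ _ => rfl⟩, ?_, ?_⟩
    · simp [h1]
    · intro j hu hw
      exact (h2 j hu hw _).symm

/-- Above level `l`, the path to `w` coincides with the path to `v`. -/
def AgreesAbove (v : TreeNode k) (l : Fin h) (w : TreeNode k) : Prop :=
  ∀ i : Fin h, l < i → ∀ hw hv, w.path i hw = v.path i hv

open Classical in
/-- Permute, by `p`, the children at level `l` below the ancestor of `v` on level `l + 1`. -/
noncomputable def permuteAt (v : TreeNode k) (l : Fin h) (p : Equiv.Perm (Fin (k l)))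
    (w : TreeNode k) : TreeNode k where
  level := w.level
  level_le := w.level_le
  path j hj := (if AgreesAbove v l w then
    Function.update (β := fun j => Equiv.Perm (Fin (k j))) (fun _ => 1) l p j else 1) (w.path j hj)

variable {v : TreeNode k} {l : Fin h}

theorem permuteAt_path_of_ne (p : Equiv.Perm (Fin (k l))) (w : TreeNode k) {j : Fin h}
    (hj : j ≠ l) (hw) : (permuteAt v l p w).path j hw = w.path j hw := by
  simp only [permuteAt]
  split_ifs
  · rw [Function.update_of_ne hj]
    rfl
  · rfl

theorem permuteAt_path_self (p : Equiv.Perm (Fin (k l))) {w : TreeNode k}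
    (hw : AgreesAbove v l w) (hl) : (permuteAt v l p w).path l hl = p (w.path l hl) := by
  simp only [permuteAt, if_pos hw, Function.update_self]

theorem permuteAt_of_not (p : Equiv.Perm (Fin (k l))) {w : TreeNode k}
    (hw : ¬ AgreesAbove v l w) : permuteAt v l p w = w :=
  eq_of_path rfl fun j _ _ => by simp [permuteAt, if_neg hw]

theorem agreesAbove_permuteAt (p : Equiv.Perm (Fin (k l))) (w : TreeNode k) :
    AgreesAbove v l (permuteAt v l p w) ↔ AgreesAbove v l w :=
  forall_congr' fun _ => forall_congr' fun hi => forall_congr' fun _ => forall_congr' fun _ => by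
    rw [permuteAt_path_of_ne p w hi.ne']

theorem permuteAt_permuteAt (p q : Equiv.Perm (Fin (k l))) (w : TreeNode k) :
    permuteAt v l p (permuteAt v l q w) = permuteAt v l (p * q) w := by
  by_cases hw : AgreesAbove v l w
  · refine eq_of_path rfl fun j h1 h2 => ?_
    by_cases hj : j = l
    · subst hj
      exact (permuteAt_path_self p ((agreesAbove_permuteAt q w).2 hw) h1).trans
        ((congrArg p (permuteAt_path_self q hw h1)).trans
          (permuteAt_path_self (p * q) hw h1).symm)
    · exact (permuteAt_path_of_ne p _ hj h1).trans ((permuteAt_path_of_ne q w hj h1).trans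
        (permuteAt_path_of_ne (p * q) w hj h1).symm)
  · rw [permuteAt_of_not _ hw, permuteAt_of_not _ hw, permuteAt_of_not _ hw]

theorem permuteAt_one (w : TreeNode k) : permuteAt v l 1 w = w :=
  eq_of_path rfl fun j h1 h2 => by
    by_cases hw : AgreesAbove v l w
    · by_cases hj : j = l
      · subst hj
        rw [permuteAt_path_self _ hw]
        rfl
      · rw [permuteAt_path_of_ne _ _ hj]
    · simp [permuteAt]

/-- Where both nodes have a coordinate at the permuted level, parent and child agree above it, so
the permutation acts on both or on neither. -/
theorem IsParent.permuteAt {u w : TreeNode k} (huw : IsParent u w)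
    (p : Equiv.Perm (Fin (k l))) : IsParent (permuteAt v l p u) (permuteAt v l p w) := by
  refine ⟨huw.1, fun j hu hw => ?_⟩
  by_cases hj : j = l
  · subst hj
    have hiff : AgreesAbove v j u ↔ AgreesAbove v j w := by
      have hl := huw.1
      have hu' : u.level ≤ (j : ℕ) := hu
      constructor
      · intro H i hi hw' hv'
        have : (j : ℕ) < i := hi
        rw [← huw.2 i (by omega) hw', H i hi (by omega) hv']
      · intro H i hi hu' hv'
        rw [huw.2 i hu' (by omega), H i hi (by omega) hv']
    by_cases hw' : AgreesAbove v j w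
    · rw [permuteAt_path_self _ hw', permuteAt_path_self _ (hiff.2 hw')]
      exact congrArg p (huw.2 j hu hw)
    · simp only [TreeNode.permuteAt, if_neg hw', if_neg (fun h => hw' (hiff.1 h))]
      exact huw.2 j hu hw
  · rw [permuteAt_path_of_ne _ _ hj, permuteAt_path_of_ne _ _ hj]
    exact huw.2 j hu hw

/-- The automorphism of the tree given by `permuteAt`. -/
noncomputable def permuteAtAut (v : TreeNode k) (l : Fin h) (p : Equiv.Perm (Fin (k l))) :
    treeAut k :=
  ⟨⟨permuteAt v l p, permuteAt v l p⁻¹,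
      fun w => by rw [permuteAt_permuteAt, inv_mul_cancel, permuteAt_one],
      fun w => by rw [permuteAt_permuteAt, mul_inv_cancel, permuteAt_one]⟩, by
    intro u w
    refine ⟨fun H => ?_, fun H => H.permuteAt p⟩
    have H' := IsParent.permuteAt (v := v) (l := l) H p⁻¹
    simpa only [Equiv.coe_fn_mk, permuteAt_permuteAt, inv_mul_cancel, permuteAt_one] using H'⟩

theorem agreesAbove_of_mem_block (hv : v.level < h) {w : TreeNode k} (hw : w ∈ v.block) :
    AgreesAbove v ⟨v.level, hv⟩ w :=
  ((mem_block_iff hv).1 hw).2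

theorem permuteAt_mem_block (hv : v.level < h) (p : Equiv.Perm (Fin (k ⟨v.level, hv⟩)))
    {w : TreeNode k} (hw : w ∈ v.block) : permuteAt v ⟨v.level, hv⟩ p w ∈ v.block := by
  rw [mem_block_iff hv] at hw ⊢
  refine ⟨hw.1, fun j hj hw' hv' => ?_⟩
  rw [permuteAt_path_of_ne p w (fun h => by simp [h] at hj)]
  exact hw.2 j hj _ _

theorem mem_block_self (hv : v.level < h) : v ∈ v.block :=
  (mem_block_iff hv).2 ⟨rfl, fun _ _ _ _ => rfl⟩

/-- The nodes of a block are numbered by their last coordinate. -/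
noncomputable def blockEquiv (v : TreeNode k) (hv : v.level < h) :
    v.block ≃ Fin (k ⟨v.level, hv⟩) :=
  Equiv.ofBijective (fun w => w.1.path ⟨v.level, hv⟩ ((mem_block_iff hv).1 w.2).1.le) (by
    constructor
    · rintro ⟨u, hu⟩ ⟨w, hw⟩ huw
      have hu' := (mem_block_iff hv).1 hu
      have hw' := (mem_block_iff hv).1 hw
      refine Subtype.ext (eq_of_path (hu'.1.trans hw'.1.symm) fun j h1 h2 => ?_)
      by_cases hj : j = ⟨v.level, hv⟩
      · subst hj
        exact huw
      · have h3 : v.level < (j : ℕ) := by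
          have : (j : ℕ) ≠ v.level := fun h => hj (Fin.ext h)
          have := hu'.1
          simp only at h1
          omega
        simp only
        rw [hu'.2 j h3 h1 h3.le, hw'.2 j h3 h2 h3.le]
    · intro c
      -- The node with last coordinate $c$ is obtained from $v$ by swapping its own last coordinate
      -- with $c$.
      refine ⟨⟨permuteAt v ⟨v.level, hv⟩ (Equiv.swap (v.path ⟨v.level, hv⟩ le_rfl) c) v,
        permuteAt_mem_block hv _ (mem_block_self hv)⟩, ?_⟩
      exact (permuteAt_path_self _ (agreesAbove_of_mem_block hv (mem_block_self hv)) _).trans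
        (Equiv.swap_apply_left _ _))

theorem exists_treeAut_extending (hv : v.level < h) (π : Equiv.Perm v.block) :
    ∃ τ : treeAut k, ∀ b : v.block, τ.1 b.1 = (π b).1 := by
  refine ⟨permuteAtAut v ⟨v.level, hv⟩ ((blockEquiv v hv).permCongr π), fun b => ?_⟩
  have h1 : (⟨permuteAt v ⟨v.level, hv⟩ ((blockEquiv v hv).permCongr π) b.1,
      permuteAt_mem_block hv _ b.2⟩ : v.block) = π b := by
    refine (blockEquiv v hv).injective ?_
    refine (permuteAt_path_self _ (agreesAbove_of_mem_block hv b.2) _).trans ?_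
    change (blockEquiv v hv).permCongr π (blockEquiv v hv b) = _
    simp [Equiv.permCongr_apply]
  exact congrArg Subtype.val h1

/-- `u` is `w` or an ancestor of `w`. -/
def IsAncestor (u w : TreeNode k) : Prop := Relation.ReflTransGen IsParent u w

theorem IsAncestor.path {u w : TreeNode k} (huw : IsAncestor u w) : w.level ≤ u.level ∧
    ∀ j hu hw, u.path j hu = w.path j hw := by
  induction huw with
  | refl => exact ⟨le_rfl, fun _ _ _ => rfl⟩
  | tail _ hbc ih =>
    have h1 := hbc.1
    refine ⟨by omega, fun j hu hw => ?_⟩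
    rw [ih.2 j hu (by omega), hbc.2 j (by omega) hw]

theorem IsAncestor.map {u w : TreeNode k} (huw : IsAncestor u w) (τ : treeAut k) :
    IsAncestor (τ.1 u) (τ.1 w) :=
  Relation.ReflTransGen.lift τ.1 (fun a b hab => (τ.2 a b).2 hab) _ _ huw

theorem IsAncestor.eq_of_level_eq {u u' w : TreeNode k} (hu : IsAncestor u w)
    (hu' : IsAncestor u' w) (hl : u.level = u'.level) : u = u' :=
  eq_of_path hl fun j h1 h2 => by
    have := hu.path.1
    rw [hu.path.2 j h1 (by omega), hu'.path.2 j h2 (by omega)]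

theorem exists_leaf_below (hk : ∀ i, 0 < k i) (u : TreeNode k) :
    ∃ x : TreeLeaf k, IsAncestor u x.1 := by
  obtain ⟨n, hn⟩ : ∃ n, u.level = n := ⟨_, rfl⟩
  induction n generalizing u with
  | zero => exact ⟨⟨u, hn⟩, Relation.ReflTransGen.refl⟩
  | succ n ih =>
    let w : TreeNode k := ⟨n, by have := u.level_le; omega, fun j _ =>
      if hj : u.level ≤ (j : ℕ) then u.path j hj else ⟨0, hk j⟩⟩
    have hw : IsParent u w := ⟨hn, fun j hu _ => by simp [w, hu]⟩
    obtain ⟨x, hx⟩ := ih w rfl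
    exact ⟨x, Relation.ReflTransGen.head hw hx⟩

end TreeNode

open Classical in
/-- The assignment that makes a leaf true if its ancestor in the block `B` (if any) is in `S`. -/
noncomputable def blockAssignment {h : ℕ} {k : Fin h → ℕ} {B : Set (TreeNode k)} (S : Finset B)
    (x : TreeLeaf k) : Bool :=
  decide (∀ b : B, TreeNode.IsAncestor b.1 x.1 → b ∈ S)

theorem blockAssignment_map {h : ℕ} {k : Fin h → ℕ} {B : Set (TreeNode k)} {τ : treeAut k}
    {π : Equiv.Perm B} (hτ : ∀ b : B, τ.1 b.1 = (π b).1) (S : Finset B) (x : TreeLeaf k) :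
    blockAssignment (S.map π.toEmbedding) (leafHom k τ x) = blockAssignment S x := by
  unfold blockAssignment
  refine decide_eq_decide.2 (π.forall_congr_right.symm.trans (forall_congr' fun b => ?_))
  have h1 : TreeNode.IsAncestor (π b).1 (leafHom k τ x).1 ↔ TreeNode.IsAncestor b.1 x.1 := by
    rw [← hτ b]
    refine ⟨fun H => ?_, fun H => H.map τ⟩
    have H' := H.map τ⁻¹
    have e : ∀ u, (τ⁻¹).1 (τ.1 u) = u := fun u => τ.1.symm_apply_apply u
    rwa [e, show (leafHom k τ x).1 = τ.1 x.1 from rfl, e] at H'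
  rw [h1]
  exact imp_congr Iff.rfl (Finset.mem_map' π.toEmbedding)

namespace ModCircuit

/-! ### Circuit symmetries and the values of gates -/

section Extends

variable {m : ℕ} {X : Type} {C : ModCircuit m X}

theorem Extends.mul {ρ ρ' : Equiv.Perm X} {σ σ' : Equiv.Perm C.Gate} (h1 : C.Extends ρ σ)
    (h2 : C.Extends ρ' σ') : C.Extends (ρ * ρ') (σ * σ') := by
  refine ⟨by simp [h1.1, h2.1], fun g g' => by simp [h1.2.1, h2.2.1], fun g => ?_⟩
  simp [h1.2.2, h2.2.2, Function.comp_def]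

theorem Extends.inv {ρ : Equiv.Perm X} {σ : Equiv.Perm C.Gate} (h1 : C.Extends ρ σ) :
    C.Extends ρ⁻¹ σ⁻¹ := by
  refine ⟨by rw [Equiv.Perm.inv_eq_iff_eq, h1.1], fun g g' => ?_, fun g => ?_⟩
  · have := h1.2.1 (σ⁻¹ g) (σ⁻¹ g')
    simpa using this.symm
  · have h5 : C.label g = Sum.map ρ id (C.label (σ⁻¹ g)) := by
      simpa using h1.2.2 (σ⁻¹ g)
    rw [h5, Sum.map_map]
    simp

theorem Extends.eval_eq {ρ : Equiv.Perm X} {σ : Equiv.Perm C.Gate} (h1 : C.Extends ρ σ)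
    {a a' : X → Bool} (ha : ∀ x, a' (ρ x) = a x) (g : C.Gate) :
    C.eval a' (σ g) = C.eval a g := by
  induction g using C.acyclic.induction with
  | _ g ih =>
    rw [C.eval_eq a', C.eval_eq a, h1.2.2 g]
    cases C.label g with
    | inl x => exact ha x
    | inr R =>
      simp only [Sum.map_inr, id_eq]
      congr 2
      rw [← Equiv.sum_comp σ]
      refine Finset.sum_congr rfl fun g' _ => ?_
      rw [h1.2.1]
      rcases Nat.eq_zero_or_pos (C.wires g' g) with h0 | h0
      · simp [h0]
      · rw [ih g' h0]

open Classical in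
/-- If every gate has a small set `T g` such that the even permutations fixing it pointwise are
realised by symmetries fixing `g`, then the value of `g` on `S` only depends on `S ∩ T g` and on
the size of `S` modulo a fixed period. -/
theorem eq_of_inter_eq_of_card_modEq (hm : 0 < m) {s : ℕ} {β : Type} [Fintype β] [DecidableEq β]
    (f : C.Gate → Finset β → Bool)
    (hf : ∀ g R, C.label g = Sum.inr R → ∀ S, f g S =
      decide ((∑ g', (C.wires g' g : ZMod m) * ((f g' S).toNat : ZMod m)) ∈ R))
    (T : C.Gate → Finset β) (hT : ∀ g, (T g).card ≤ s)
    (Sym : Equiv.Perm β → Equiv.Perm C.Gate → Prop)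
    (hSf : ∀ {π σ}, Sym π σ → ∀ g S, f (σ g) (S.map π.toEmbedding) = f g S)
    (hSw : ∀ {π σ}, Sym π σ → ∀ g g', C.wires (σ g) (σ g') = C.wires g g')
    (hST : ∀ {π σ}, Sym π σ → ∀ g, T (σ g) = (T g).map π.toEmbedding)
    (hfix : ∀ g π, Equiv.Perm.sign π = 1 → (∀ b ∈ T g, π b = b) → ∃ σ, Sym π σ ∧ σ g = g)
    (hin : ∀ g x, C.label g = Sum.inl x → ∀ S S', S ∩ T g = S' ∩ T g → f g S = f g S')
    (hn : 2 * s + 2 ≤ Fintype.card β) (g : C.Gate) :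
    ∀ S S' : Finset β, S ∩ T g = S' ∩ T g → S.card ≡ S'.card [MOD choosePeriod m s] →
      f g S = f g S' := by
  induction g using C.acyclic.induction with
  | _ g ih =>
    intro S S' hSS' hcard
    cases hlab : C.label g with
    | inl x => exact hin g x hlab S S' hSS'
    | inr R =>
      rw [hf g R hlab, hf g R hlab]
      -- With the class of $|S|$ fixed, $\varphi$ records the value of $g'$ as a function of the
      -- trace on $T(g')$ alone. By the induction hypothesis the choice of $V$ is irrelevant for the
      -- gates wired to $g$.
      let φ : C.Gate → Finset β → ZMod m := fun g' U =>
        if ∃ V : Finset β, V ∩ T g' = U ∧ V.card ≡ S.card [MOD choosePeriod m s] ∧ f g' V = true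
        then 1 else 0
      let G : Finset β → Finset β → ZMod m := fun U A =>
        ∑ g' with T g' = A, (C.wires g' g : ZMod m) * φ g' U
      have hφ : ∀ g', 0 < C.wires g' g → ∀ V : Finset β,
          V.card ≡ S.card [MOD choosePeriod m s] →
          ((f g' V).toNat : ZMod m) = φ g' (V ∩ T g') := by
        intro g' hg' V hV
        cases hfV : f g' V with
        | true => simp only [φ]; rw [if_pos ⟨V, rfl, hV, hfV⟩]; simp
        | false =>
          simp only [φ]
          rw [if_neg]
          · simp
          · rintro ⟨V', h1, h2, h3⟩
            rw [ih g' hg' V' V h1 (h2.trans hV.symm), hfV] at h3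
            exact absurd h3 (by simp)
      have hsum : ∀ V : Finset β, V.card ≡ S.card [MOD choosePeriod m s] →
          ∑ g', (C.wires g' g : ZMod m) * ((f g' V).toNat : ZMod m) = ∑ A, G (V ∩ A) A := by
        intro V hV
        rw [← Finset.sum_fiberwise (s := Finset.univ) (g := T)]
        refine Finset.sum_congr rfl fun A _ => Finset.sum_congr rfl fun g' hg' => ?_
        rw [← (Finset.mem_filter.1 hg').2]
        rcases Nat.eq_zero_or_pos (C.wires g' g) with h0 | h0
        · simp [h0]
        · rw [hφ g' h0 V hV]
      have hG0 : ∀ U A, s < A.card → G U A = 0 := by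
        intro U A hA
        refine Finset.sum_eq_zero fun g' hg' => ?_
        rw [← (Finset.mem_filter.1 hg').2] at hA
        exact absurd (hT g') (by omega)
      -- A symmetry that fixes $g$ permutes the gates feeding $g$ and preserves multiplicities, so
      -- it only reorders the sum.
      have hG : ∀ π : Equiv.Perm β, Equiv.Perm.sign π = 1 → (∀ b ∈ T g, π b = b) → ∀ U A,
          G (U.map π.toEmbedding) (A.map π.toEmbedding) = G U A := by
        intro π hπ hπT U A
        obtain ⟨σ, hσ, hσg⟩ := hfix g π hπ hπT
        have hφσ : ∀ g', φ (σ g') (U.map π.toEmbedding) = φ g' U := by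
          intro g'
          simp only [φ]
          refine if_congr ?_ rfl rfl
          rw [← (Equiv.finsetCongr π).surjective.exists.symm]
          refine exists_congr fun V => ?_
          rw [Equiv.finsetCongr_apply, hST hσ, ← Finset.map_inter, Finset.map_inj,
            Finset.card_map, hSf hσ]
        simp only [G, Finset.sum_filter]
        rw [← Equiv.sum_comp σ]
        refine Finset.sum_congr rfl fun g' _ => ?_
        have hw := hSw hσ g' g
        rw [hσg] at hw
        rw [hφσ, hw, hST hσ]
        simp only [Finset.map_inj]
      rw [hsum S rfl, hsum S' hcard.symm,
        sum_inter_eq_of_even_invariant hm (T g) (hT g) hn G hG0 hG hSS' hcard]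

end Extends

/-! ### Restricted stabilisers, supports and the two bounds for AND -/

section Tree

variable {m h : ℕ} {k : Fin h → ℕ} {C : ModCircuit m (TreeLeaf k)} {B : Set (TreeNode k)}

theorem conj_mem_restrictToBlock {τ : treeAut k} {σ : Equiv.Perm C.Gate}
    (hσ : C.Extends (leafHom k τ) σ) {π : Equiv.Perm B} (hπ : ∀ b : B, τ.1 b.1 = (π b).1)
    {g : C.Gate} {x : Equiv.Perm B} (hx : x ∈ restrictToBlock (C.gateStab g) B) :
    π * x * π⁻¹ ∈ restrictToBlock (C.gateStab (σ g)) B := by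
  obtain ⟨τ', ⟨σ', hσ', hg⟩, hx'⟩ := hx
  refine ⟨τ * τ' * τ⁻¹, ⟨σ * σ' * σ⁻¹, ?_, by simp [hg]⟩, fun b => ?_⟩
  · rw [map_mul, map_mul, map_inv]
    exact (hσ.mul hσ').mul hσ.inv
  · have h1 : τ⁻¹.1 b.1 = (π⁻¹ b).1 := by
      change τ.1⁻¹ b.1 = _
      rw [Equiv.Perm.inv_eq_iff_eq, hπ]
      simp
    change τ.1 (τ'.1 (τ⁻¹.1 b.1)) = (π (x (π⁻¹ b))).1
    rw [h1, hx', hπ]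

theorem conj_mem_restrictToBlock_iff {τ : treeAut k} {σ : Equiv.Perm C.Gate}
    (hσ : C.Extends (leafHom k τ) σ) {π : Equiv.Perm B} (hπ : ∀ b : B, τ.1 b.1 = (π b).1)
    (g : C.Gate) (x : Equiv.Perm B) :
    π * x * π⁻¹ ∈ restrictToBlock (C.gateStab (σ g)) B ↔
      x ∈ restrictToBlock (C.gateStab g) B := by
  refine ⟨fun H => ?_, conj_mem_restrictToBlock hσ hπ⟩
  have hσ' : C.Extends (leafHom k τ⁻¹) σ⁻¹ := by
    rw [map_inv]
    exact hσ.inv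
  have H' := conj_mem_restrictToBlock hσ' (π := π⁻¹) (fun b => by
    change τ.1⁻¹ b.1 = _
    rw [Equiv.Perm.inv_eq_iff_eq, hπ]
    simp) H
  simpa [mul_assoc] using H'

theorem exists_treeAut_of_mem_treeBlocks (hB : B ∈ treeBlocks k) (π : Equiv.Perm B) :
    ∃ τ : treeAut k, ∀ b : B, τ.1 b.1 = (π b).1 := by
  obtain ⟨v, hv, rfl⟩ := hB
  exact TreeNode.exists_treeAut_extending hv π

theorem level_eq_of_mem_treeBlocks (hB : B ∈ treeBlocks k) (b c : B) :
    b.1.level = c.1.level := by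
  obtain ⟨v, hv, rfl⟩ := hB
  rw [((TreeNode.mem_block_iff hv).1 b.2).1, ((TreeNode.mem_block_iff hv).1 c.2).1]

/-- The index of the stabiliser of a gate, restricted to a block, is at most the number of gates. -/
theorem index_restrictToBlock_le (hC : C.IsSymmetric (leafHom k).range) (hB : B ∈ treeBlocks k)
    (g : C.Gate) : (restrictToBlock (C.gateStab g) B).index ≤ Fintype.card C.Gate := by
  choose τ hτ using exists_treeAut_of_mem_treeBlocks hB
  choose σ hσ using fun π => hC (leafHom k (τ π)) ⟨τ π, rfl⟩
  rw [Subgroup.index, ← Nat.card_eq_fintype_card]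
  -- Cosets are sent to images of $g$. Whichever extensions were chosen, two that agree at $g$
  -- differ by a symmetry fixing $g$.
  refine Nat.card_le_card_of_injective
    (fun q : Equiv.Perm B ⧸ restrictToBlock (C.gateStab g) B => σ q.out g) fun q q' hq => ?_
  rw [← q.out_eq', ← q'.out_eq']
  refine QuotientGroup.eq.2 ?_
  refine ⟨(τ q.out)⁻¹ * τ q'.out, ⟨(σ q.out)⁻¹ * σ q'.out, ?_, ?_⟩, fun b => ?_⟩
  · rw [map_mul, map_inv]
    exact (hσ _).inv.mul (hσ _)
  · change (σ q.out)⁻¹ (σ q'.out g) = g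
    rw [Equiv.Perm.inv_eq_iff_eq]
    exact hq.symm
  · change (τ q.out).1⁻¹ ((τ q'.out).1 b.1) = _
    rw [Equiv.Perm.inv_eq_iff_eq, hτ, hτ]
    simp

/-- An element of the stabiliser of an input gate fixes the node of the block above its leaf. -/
theorem apply_eq_of_mem_restrictToBlock (hB : B ∈ treeBlocks k) {g : C.Gate} {x : TreeLeaf k}
    (hg : C.label g = Sum.inl x) {b : B} (hb : TreeNode.IsAncestor b.1 x.1) {π : Equiv.Perm B}
    (hπ : π ∈ restrictToBlock (C.gateStab g) B) : π b = b := by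
  obtain ⟨τ, ⟨σ, hσ, hσg⟩, hτ⟩ := hπ
  have h1 := hσ.2.2 g
  rw [hσg, hg, Sum.map_inl, Sum.inl.injEq] at h1
  have h2 := hb.map τ
  rw [hτ, show τ.1 x.1 = (leafHom k τ x).1 from rfl, ← h1] at h2
  exact Subtype.ext (h2.eq_of_level_eq hb (level_eq_of_mem_treeBlocks hB _ _))

/-- The common core of both statements: the value of the root depends only on $|S|$ modulo a period
that is smaller than the block. -/
theorem not_computesAnd_of_even_supports (hm : 0 < m) (hk : ∀ i, 0 < k i)
    (hC : C.IsSymmetric (leafHom k).range) (hB : B ∈ treeBlocks k) [Fintype B] [DecidableEq B]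
    {s : ℕ} (T : C.Gate → Finset B) (hT : ∀ g, (T g).card ≤ s)
    (hTmap : ∀ (τ : treeAut k) (π : Equiv.Perm B) (σ : Equiv.Perm C.Gate),
      C.Extends (leafHom k τ) σ → (∀ b : B, τ.1 b.1 = (π b).1) →
        ∀ g, T (σ g) = (T g).map π.toEmbedding)
    (hTfix : ∀ (g : C.Gate) (π : Equiv.Perm B), Equiv.Perm.sign π = 1 →
      (∀ b ∈ T g, π b = b) → π ∈ restrictToBlock (C.gateStab g) B)
    (hs : m * s ^ m.primeFactors.card < Fintype.card B) (hn : 2 * s + 3 ≤ Fintype.card B) :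
    ¬ C.ComputesAnd := by
  intro hand
  have hinput : ∀ (g : C.Gate) (x : TreeLeaf k), C.label g = Sum.inl x →
      ∀ b : B, TreeNode.IsAncestor b.1 x.1 → b ∈ T g := by
    intro g x hg b hb
    by_contra hbT
    -- Otherwise a three-cycle through $b$ and two further points outside $T(g)$ would be an even
    -- permutation induced from the stabiliser of the input gate, yet it moves $b$.
    have h1 : 2 < ((T g)ᶜ).card := by
      have := hT g
      rw [Finset.card_compl]
      omega
    have h2 : 1 < ((T g)ᶜ.erase b).card := by
      rw [Finset.card_erase_of_mem (by simpa using hbT)]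
      omega
    obtain ⟨c, hc, d, hd, hcd⟩ := Finset.one_lt_card.1 h2
    simp only [Finset.mem_erase, Finset.mem_compl] at hc hd
    have h3 := apply_eq_of_mem_restrictToBlock hB hg hb (hTfix g (threeCycle b c d)
      (by simp [threeCycle, Equiv.Perm.sign_swap hc.1.symm, Equiv.Perm.sign_swap hcd])
      fun e he => threeCycle_apply_of_ne (fun h => hbT (h ▸ he)) (fun h => hc.2 (h ▸ he))
        fun h => hd.2 (h ▸ he))
    rw [threeCycle_apply_fst hc.1.symm hd.1.symm] at h3
    exact hc.1 h3
  have hpos : 0 < Fintype.card B := by omega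
  have hspos : 0 < s := by
    obtain ⟨b⟩ := Fintype.card_pos_iff.1 hpos
    obtain ⟨x, hx⟩ := TreeNode.exists_leaf_below hk b.1
    obtain ⟨g, hg, -⟩ := C.existsUnique_input x
    exact (Finset.card_pos.2 ⟨b, hinput g x hg b hx⟩).trans_le (hT g)
  have hper := (choosePeriod_le m hspos).trans_lt hs
  -- Every symmetry fixes the root, so $T$ of the root is invariant under all permutations of $B$.
  -- It is too small to be all of $B$.
  have hroot : T C.root = ∅ := by
    rw [Finset.eq_empty_iff_forall_notMem]
    intro b hb
    have h1 : T C.root = Finset.univ := by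
      rw [Finset.eq_univ_iff_forall]
      intro c
      obtain ⟨τ, hτ⟩ := exists_treeAut_of_mem_treeBlocks hB (Equiv.swap b c)
      obtain ⟨σ, hσ⟩ := hC (leafHom k τ) ⟨τ, rfl⟩
      have h2 := hTmap τ _ σ hσ hτ C.root
      rw [hσ.1] at h2
      rw [h2]
      exact Finset.mem_map.2 ⟨b, hb, Equiv.swap_apply_left b c⟩
    have h2 := hT C.root
    rw [h1, Finset.card_univ] at h2
    omega
  have key := eq_of_inter_eq_of_card_modEq hm (C := C) (fun g S => C.eval (blockAssignment S) g)
    (fun g R hg S => by simp only [C.eval_eq _ g, hg]) T hT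
    (fun π σ => ∃ τ : treeAut k, C.Extends (leafHom k τ) σ ∧ ∀ b : B, τ.1 b.1 = (π b).1)
    (fun ⟨_, hσ, hτ⟩ g S => hσ.eval_eq (blockAssignment_map hτ S) g)
    (fun ⟨_, hσ, _⟩ => hσ.2.1)
    (fun ⟨τ, hσ, hτ⟩ => hTmap τ _ _ hσ hτ)
    (fun g π hπ hπT => by
      obtain ⟨τ, ⟨σ, hσ, hσg⟩, hτ⟩ := hTfix g π hπ hπT
      exact ⟨σ, ⟨τ, hσ, hτ⟩, hσg⟩)
    (fun g x hg S S' hSS' => by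
      simp only [C.eval_eq _ g, hg, blockAssignment]
      refine decide_eq_decide.2 (forall_congr' fun b => forall_congr' fun hb => ?_)
      have hbT := hinput g x hg b hb
      have h1 := Finset.ext_iff.1 hSS' b
      simpa [hbT] using h1)
    (by omega) C.root
  -- $S$ is smaller than $B$ by exactly one period, so the root also accepts $S$, although some leaf
  -- below $B\setminus S$ is false.
  obtain ⟨S, -, hS⟩ := Finset.exists_subset_card_eq
    (show Fintype.card B - choosePeriod m s ≤ (Finset.univ : Finset B).card by
      rw [Finset.card_univ]; omega)
  have h1 := key Finset.univ S (by rw [hroot]; simp) (by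
    rw [Finset.card_univ, hS]
    refine ((Nat.modEq_iff_dvd' (Nat.sub_le _ _)).2 ?_).symm
    rw [Nat.sub_sub_self hper.le])
  have h2 : C.eval (blockAssignment (Finset.univ : Finset B)) C.root = true :=
    (hand _).2 fun x => by simp [blockAssignment]
  have h3 := (hand _).1 (h1 ▸ h2)
  have h4 : S = Finset.univ := by
    rw [Finset.eq_univ_iff_forall]
    intro b
    obtain ⟨x, hx⟩ := TreeNode.exists_leaf_below hk b.1
    have h5 : ∀ b : B, TreeNode.IsAncestor b.1 x.1 → b ∈ S := by
      simpa [blockAssignment] using h3 x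
    exact h5 b hx
  rw [h4, Finset.card_univ] at hS
  have := choosePeriod_pos hm s
  omega

theorem supp_isMinSupport {g : C.Gate} (hg : C.SupportDefined B g) :
    C.IsMinSupport B g (C.supp B g) := by
  unfold supp
  rw [dif_pos hg]
  exact hg.choose_spec.1

theorem eq_supp_of_isMinSupport {g : C.Gate} (hg : C.SupportDefined B g) {S : Set B}
    (hS : C.IsMinSupport B g S) : S = C.supp B g :=
  hg.unique hS (supp_isMinSupport hg)

theorem isBlockSupport_image_iff {τ : treeAut k} {σ : Equiv.Perm C.Gate}
    (hσ : C.Extends (leafHom k τ) σ) {π : Equiv.Perm B} (hπ : ∀ b : B, τ.1 b.1 = (π b).1)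
    (g : C.Gate) (S : Set B) :
    IsBlockSupport (C.gateStab (σ g)) B (π '' S) ↔ IsBlockSupport (C.gateStab g) B S := by
  have hfix : ∀ x : Equiv.Perm B, π * x * π⁻¹ ∈ fixingSubgroup (Equiv.Perm B) (π '' S) ↔
      x ∈ fixingSubgroup (Equiv.Perm B) S := by
    intro x
    rw [mem_fixingSubgroup_iff, mem_fixingSubgroup_iff, Set.forall_mem_image]
    exact forall_congr' fun b => forall_congr' fun _ => by simp [Equiv.Perm.smul_def]
  constructor
  · intro H x hx
    exact (conj_mem_restrictToBlock_iff hσ hπ g x).1 (H ((hfix x).2 hx))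
  · intro H x hx
    obtain ⟨y, rfl⟩ : ∃ y, x = π * y * π⁻¹ := ⟨π⁻¹ * x * π, by simp [mul_assoc]⟩
    exact (conj_mem_restrictToBlock_iff hσ hπ g y).2 (H ((hfix y).1 hx))

/-- Symmetries carry minimal supports of $g$ to minimal supports of its image; uniqueness then
forces equality. -/
theorem supp_apply {τ : treeAut k} {σ : Equiv.Perm C.Gate}
    (hσ : C.Extends (leafHom k τ) σ) {π : Equiv.Perm B} (hπ : ∀ b : B, τ.1 b.1 = (π b).1)
    (hdef : ∀ g, C.SupportDefined B g) (g : C.Gate) : C.supp B (σ g) = π '' C.supp B g := by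
  refine (eq_supp_of_isMinSupport (hdef _) ⟨?_, fun S' hS' => ?_⟩).symm
  · exact (isBlockSupport_image_iff hσ hπ g _).2 (supp_isMinSupport (hdef g)).1
  · obtain ⟨S, rfl⟩ := π.surjective.image_surjective S'
    rw [Set.ncard_image_of_injective _ π.injective, Set.ncard_image_of_injective _ π.injective]
    exact (supp_isMinSupport (hdef g)).2 S ((isBlockSupport_image_iff hσ hπ g S).1 hS')

theorem mul_pow_lt_of_lt_rpow {s n r : ℕ} (hm : 0 < m) (hr : 0 < r)
    (hs : (s : ℝ) < ((n : ℝ) / (m : ℝ)) ^ ((1 : ℝ) / (r : ℝ))) : m * s ^ r < n := by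
  have hm' : (0 : ℝ) < m := by exact_mod_cast hm
  have h1 : (s : ℝ) ^ r < (n : ℝ) / m := by
    have h2 := pow_lt_pow_left₀ hs (Nat.cast_nonneg s) hr.ne'
    rwa [one_div, Real.rpow_inv_natCast_pow (by positivity) hr.ne'] at h2
  rw [lt_div_iff₀ hm'] at h1
  rw [mul_comm]
  exact_mod_cast h1

theorem finite_of_mem_treeBlocks (hB : B ∈ treeBlocks k) : Finite B := by
  obtain ⟨v, hv, rfl⟩ := hB
  exact Finite.of_equiv _ (TreeNode.blockEquiv v hv).symm

theorem not_computesAnd_of_maxSup_lt (hm : 3 < m) (hk : ∀ i, 0 < k i)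
    (hC : C.IsSymmetric (leafHom k).range) (hB : B ∈ treeBlocks k) (h2 : 2 ≤ B.ncard)
    (hdef : ∀ g, C.SupportDefined B g)
    (hs : (C.maxSup B : ℝ) <
      ((B.ncard : ℝ) / (m : ℝ)) ^ ((1 : ℝ) / (m.primeFactors.card : ℝ))) :
    ¬ C.ComputesAnd := by
  classical
  have := finite_of_mem_treeBlocks hB
  have : Fintype B := Fintype.ofFinite B
  have hcard : B.ncard = Fintype.card B := by
    rw [← Nat.card_coe_set_eq, Nat.card_eq_fintype_card]
  rw [hcard] at h2 hs
  have hr : 0 < m.primeFactors.card :=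
    Finset.card_pos.2 (Nat.nonempty_primeFactors.2 (by omega))
  have hs' := mul_pow_lt_of_lt_rpow (by omega) hr hs
  have hle : ∀ g, (C.supp B g).ncard ≤ C.maxSup B := fun g =>
    Finset.le_sup (f := fun g => (C.supp B g).ncard) (Finset.mem_univ g)
  -- An input gate below $b$ cannot have empty support, since a transposition moves $b$. With
  -- $s\ge1$ and $m\ge4$ one gets $2s+3\le4s+1\le N$.
  have hpos : 0 < C.maxSup B := by
    obtain ⟨b, c, hbc⟩ := Fintype.one_lt_card_iff.1 (show 1 < Fintype.card B by omega)
    obtain ⟨x, hx⟩ := TreeNode.exists_leaf_below hk b.1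
    obtain ⟨g, hg, -⟩ := C.existsUnique_input x
    refine lt_of_lt_of_le ?_ (hle g)
    rw [Set.ncard_pos (Set.toFinite _), Set.nonempty_iff_ne_empty]
    intro hempty
    have h3 := (supp_isMinSupport (hdef g)).1
    rw [hempty] at h3
    have h4 := apply_eq_of_mem_restrictToBlock hB hg hx
      (h3 (show Equiv.swap b c ∈ fixingSubgroup (Equiv.Perm B) ∅ by simp))
    rw [Equiv.swap_apply_left] at h4
    exact hbc h4.symm
  have h4 : 4 * C.maxSup B ≤ m * C.maxSup B ^ m.primeFactors.card :=
    Nat.mul_le_mul hm (Nat.le_self_pow hr.ne' _)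
  refine not_computesAnd_of_even_supports (by omega) hk hC hB
    (fun g => (C.supp B g).toFinset) (fun g => ?_) (fun τ π σ hσ hπ g => ?_)
    (fun g π _ hfix => ?_) hs' (by omega)
  · rw [← Set.ncard_eq_toFinset_card']
    exact hle g
  · ext b
    rw [Set.mem_toFinset, supp_apply hσ hπ hdef g, Finset.mem_map, Set.mem_image]
    simp only [Set.mem_toFinset, Equiv.coe_toEmbedding]
  · refine (supp_isMinSupport (hdef g)).1 ?_
    rw [mem_fixingSubgroup_iff]
    intro b hb
    exact hfix b (by simpa using hb)

theorem choose_le_card_gate (hm : 3 < m) (hk : ∀ i, 0 < k i)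
    (hC : C.IsSymmetric (leafHom k).range) (hand : C.ComputesAnd) (hB : B ∈ treeBlocks k)
    (h9 : 9 ≤ B.ncard) :
    B.ncard.choose ⌈((B.ncard : ℝ) / (m : ℝ)) ^ ((1 : ℝ) / (m.primeFactors.card : ℝ))⌉₊ ≤
      Fintype.card C.Gate := by
  classical
  have := finite_of_mem_treeBlocks hB
  have : Fintype B := Fintype.ofFinite B
  have hcard : B.ncard = Fintype.card B := by
    rw [← Nat.card_coe_set_eq, Nat.card_eq_fintype_card]
  rw [hcard] at h9 ⊢
  have hr : 0 < m.primeFactors.card :=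
    Finset.card_pos.2 (Nat.nonempty_primeFactors.2 (by omega))
  have hm' : (0 : ℝ) < m := by exact_mod_cast (show 0 < m by omega)
  have hn' : (0 : ℝ) < Fintype.card B := by exact_mod_cast (show 0 < Fintype.card B by omega)
  obtain ⟨t, ht⟩ : ∃ t, t = ⌈((Fintype.card B : ℝ) / (m : ℝ)) ^
    ((1 : ℝ) / (m.primeFactors.card : ℝ))⌉₊ := ⟨_, rfl⟩
  have htpos : 0 < t := by
    rw [ht, Nat.ceil_pos]
    positivity
  rw [← ht]
  by_contra! hlt
  -- The sets $T(g)$ will have at most $t-1$ elements, which lies strictly below the root by the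
  -- choice of the ceiling. It also gives $4(t-1)<N$, hence $4t\le N+3$ for the group-theoretic
  -- bound.
  have hs : ((t - 1 : ℕ) : ℝ) < ((Fintype.card B : ℝ) / (m : ℝ)) ^
      ((1 : ℝ) / (m.primeFactors.card : ℝ)) := Nat.lt_ceil.1 (by omega)
  have hs' := mul_pow_lt_of_lt_rpow (by omega) hr hs
  have h4 : 4 * (t - 1) ≤ m * (t - 1) ^ m.primeFactors.card :=
    Nat.mul_le_mul hm (Nat.le_self_pow hr.ne' _)
  have hspec := fun g => smallClasses_spec (t := t) h9 (by omega)
    ((index_restrictToBlock_le hC hB g).trans_lt hlt)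
  refine not_computesAnd_of_even_supports (by omega) hk hC hB
    (fun g => smallClasses (restrictToBlock (C.gateStab g) B))
    (fun g => Nat.le_sub_one_of_lt (hspec g).1)
    (fun τ π σ hσ hπ g => smallClasses_map (conj_mem_restrictToBlock_iff hσ hπ g))
    (fun g π => (hspec g).2 π) hs' (by omega) hand

end Tree

end ModCircuit

theorem exists_mem_treeBlocks_ncard_eq {h : ℕ} {k : Fin h → ℕ} (hk : ∀ i, 0 < k i) (j : Fin h) :
    ∃ B ∈ treeBlocks k, B.ncard = k j := by
  let v : TreeNode k := ⟨j, j.2.le, fun i _ => ⟨0, hk i⟩⟩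
  refine ⟨v.block, ⟨v, j.2, rfl⟩, ?_⟩
  rw [← Nat.card_coe_set_eq, Nat.card_congr (TreeNode.blockEquiv v j.2), Nat.card_fin]

theorem mainTheorem6 (m : ℕ) (hm : 3 < m) (r : ℕ) (hr : r = m.primeFactors.card)
    (h : ℕ) (k : Fin h → ℕ) (n : ℕ) (hn : 0 < n) (hk : ∏ i, k i = n)
    (C : ModCircuit m (TreeLeaf k)) (hC : C.IsSymmetric (leafHom k).range) :
    (∀ B ∈ treeBlocks k, ∀ j : Fin h, B.ncard = k j → 2 ≤ k j →
      (∀ g, C.SupportDefined B g) →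
      (C.maxSup B : ℝ) < ((k j : ℝ) / (m : ℝ)) ^ ((1 : ℝ) / (r : ℝ)) →
      ¬ C.ComputesAnd) ∧
    ((∀ i, 8 < k i) → C.ComputesAnd →
      (Finset.univ.sup k).choose
          ⌈(((Finset.univ.sup k : ℕ) : ℝ) / (m : ℝ)) ^ ((1 : ℝ) / (r : ℝ))⌉₊
        ≤ Fintype.card C.Gate) := by
  subst hr
  have hk0 : ∀ i, 0 < k i := fun i => Nat.pos_of_ne_zero fun h0 => by
    rw [Finset.prod_eq_zero (Finset.mem_univ i) h0] at hk
    omega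
  refine ⟨fun B hB j hBj h2 hdef hs => ?_, fun h8 hand => ?_⟩
  · rw [← hBj] at h2 hs
    exact ModCircuit.not_computesAnd_of_maxSup_lt hm hk0 hC hB h2 hdef hs
  -- For $h=0$ there is no block: the maximum is $0$ by convention, and the binomial coefficient is
  -- at most $1$.
  · rcases Nat.eq_zero_or_pos h with rfl | hpos
    · rw [Finset.univ_eq_empty, Finset.sup_empty]
      refine le_trans ?_ (Fintype.card_pos_iff.2 ⟨C.root⟩)
      have hchoose : ∀ x, Nat.choose 0 x ≤ 1 := fun x => by cases x <;> simp
      exact hchoose _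
    · obtain ⟨j, -, hj⟩ := Finset.exists_mem_eq_sup Finset.univ ⟨⟨0, hpos⟩, Finset.mem_univ _⟩ k
      obtain ⟨B, hB, hBj⟩ := exists_mem_treeBlocks_ncard_eq hk0 j
      rw [hj, ← hBj]
      exact ModCircuit.choose_le_card_gate hm hk0 hC hand hB (by have := h8 j; omega)
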